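/- Let $a,b$ be integers with $1<a<b$ and $\gcd(a,b)=1$. For real $x$ let $N_{a,b}(x)$ be the number of pairs $(p,q)$ of nonnegative integers with $a^pb^q\le x$, let $\chi_{S_{a,b}}$ be the characteristic function of $S_{a,b}=\{a^pb^q:p,q\in\mathbb Z_{\ge0}\}$, and for real $y$ put $B_1^*(\{y\})=\{y\}-\tfrac12$ if $y\notin\mathbb Z$ and $B_1^*(\{y\})=0$ if $y\in\mathbb Z$, where $\{y\}$ is the fractional part of $y$. Then for every real $x\ge 1$ $$\begin{aligned}N_{a,b}(x)&=\frac{\log(x)^2}{2\log(a)\log(b)}+\frac{\log(x)}{2\log(a)}+\frac{\log(x)}{2\log(b)}+\frac14+\frac{\log(a)}{12\log(b)}+\frac{\log(b)}{12\log(a)}\\&\quad-\frac12B_1^*\left(\left\{\frac{\log(x)}{\log(a)}\right\}\right)-\frac12B_1^*\left(\left\{\frac{\log(x)}{\log(b)}\right\}\right)\\&\quad-\frac1{2\pi}\left(\sum_{k=1}^\infty\frac{\cos\left(\frac{\pi k\log(b)}{\log(a)}\right)\cos\left(2\pi k\frac{\log(x)}{\log(a)}\right)}{k\sin\left(\frac{\pi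 k\log(b)}{\log(a)}\right)}+\sum_{k=1}^\infty\frac{\cos\left(\frac{\pi k\log(a)}{\log(b)}\right)\cos\left(2\pi k\frac{\log(x)}{\log(b)}\right)}{k\sin\left(\frac{\pi k\log(a)}{\log(b)}\right)}\right)+\frac12\chi_{S_{a,b}}(x).\end{aligned}$$ Here the sum of the two series means the limit, as $R\to\infty$, of the sum of the first series truncated at $k\le\lfloor R\log(a)\rfloor$ and the second truncated at $k\le\lfloor R\log(b)\rfloor$, where $R$ runs through real numbers for which $R\log(a)$ and $R\log(b)$ both have distance at least $\delta$ from every integer. For every $\delta>0$ the truncated sums converge to this same value along such $R$, and for some $\delta>0$ there are arbitrarily large such $R$. In particular, for every real $x\ge1$ the formula holds with $a=2$, $b=3$, that is, $$\begin{aligned}N_{2,3}(x)&=\frac{\log(x)^2}{2\log(2)\log(3)}+\frac{\log(x)}{2\log(2)}+\frac{\log(x)}{2\log(3)}+\frac14+\frac{\log(2)}{12\log(3)}+\frac{\log(3)}{12\log(2)}\\&\quad-\frac12B_1^*\left(\left\{\frac{\log(x)}{\log(2)}\right\}\right)-\frac12B_1^*\left(\left\{\frac{\log(x)}{\log(3)}\right\}\right)\\&\quad-\frac1{2\pi}\left(\sum_{k=1}^\infty\frac{\cos\left(\frac{\pi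 k\log(3)}{\log(2)}\right)\cos\left(2\pi k\frac{\log(x)}{\log(2)}\right)}{k\sin\left(\frac{\pi k\log(3)}{\log(2)}\right)}+\sum_{k=1}^\infty\frac{\cos\left(\frac{\pi k\log(2)}{\log(3)}\right)\cos\left(2\pi k\frac{\log(x)}{\log(3)}\right)}{k\sin\left(\frac{\pi k\log(2)}{\log(3)}\right)}\right)+\frac12\chi_{S_{2,3}}(x),\end{aligned}$$ with the series interpreted in the same way. -/

import Mathlib

/-- `N_{a,b}(x)`: the number of pairs `(p, q)` of nonnegative integers with `a ^ p * b ^ q ≤ x`. -/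
noncomputable def countN (a b : ℕ) (x : ℝ) : ℕ :=
  Set.ncard {pq : ℕ × ℕ | (a : ℝ) ^ pq.1 * (b : ℝ) ^ pq.2 ≤ x}

/-- `S_{a,b}`, the set of numbers `a ^ p * b ^ q` with `p, q` nonnegative integers, inside `ℝ`. -/
def smoothSet (a b : ℕ) : Set ℝ :=
  {y : ℝ | ∃ p q : ℕ, y = (a : ℝ) ^ p * (b : ℝ) ^ q}

/-- The characteristic function of `S_{a,b}`. -/
noncomputable def chiS (a b : ℕ) : ℝ → ℝ :=
  (smoothSet a b).indicator (fun _ => 1)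

open Classical in
/-- The function `y ↦ B₁^*({y})`: `{y} - 1/2` for `y` not an integer, and `0` for `y` an integer. -/
noncomputable def bernoulliStar (y : ℝ) : ℝ :=
  if ∃ n : ℤ, y = n then 0 else Int.fract y - 1 / 2

/-- The partial sum up to `K` of
`∑ cos (π k log b / log a) cos (2 π k log x / log a) / (k sin (π k log b / log a))`. -/
noncomputable def cotPartialSum (a b : ℕ) (x : ℝ) (K : ℕ) : ℝ :=
  ∑ k ∈ Finset.Icc 1 K,
    Real.cos (Real.pi * k * Real.log b / Real.log a) *
        Real.cos (2 * Real.pi * k * (Real.log x / Real.log a)) /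
      (k * Real.sin (Real.pi * k * Real.log b / Real.log a))

/-- The two series (the second one with `a` and `b` swapped), truncated at the common height `R`:
the first at `k ≤ R log a`, the second at `k ≤ R log b`. -/
noncomputable def truncatedSum (a b : ℕ) (x R : ℝ) : ℝ :=
  cotPartialSum a b x ⌊R * Real.log a⌋₊ + cotPartialSum b a x ⌊R * Real.log b⌋₊

/-- The truncation heights `R` for which both `R log a` and `R log b` have distance at least `δ`
from every integer. -/
def separatedHeights (a b : ℕ) (δ : ℝ) : Set ℝ :=
  {R : ℝ | ∀ n : ℤ, δ ≤ |R * Real.log a - n| ∧ δ ≤ |R * Real.log b - n|}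

/-- `L` is the joint value of the two series: the limit of `truncatedSum a b x R` as `R → ∞` with
`R log a` and `R log b` bounded away from the integers. Such heights exist beyond every bound, and
the limit is `L` for every choice of the distance `δ`. -/
def IsSeriesValue (a b : ℕ) (x L : ℝ) : Prop :=
  (∃ δ : ℝ, 0 < δ ∧ ∀ M : ℝ, ∃ R ∈ separatedHeights a b δ, M ≤ R) ∧
  ∀ δ : ℝ, 0 < δ →
    Filter.Tendsto (truncatedSum a b x)
      (Filter.atTop ⊓ Filter.principal (separatedHeights a b δ)) (nhds L)

open Filter Topology

/-! Put `α = log a`, `β = log b`, `t = log x`. Then `N(x) - χ(x) / 2` counts the lattice points with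
`p α + q β ≤ t`, points on the boundary line having weight one half (`starCount`). Coprimality makes
`β / α` irrational, so no denominator of the series vanishes.

For `-α ≤ t < 0` nothing is counted, and the formula is a residue computation. With `u = t + (α + β)
/ 2`, integrate `cos (2 π u z) / (z sin (π α z) sin (π β z))` over `|z| = R`. The residues at `k /
α` and `k / β` are the terms of the two series up to sawtooth Fourier terms
(`cotSum_eq_poleResidue`), which produce the `B₁^*` contributions; the residue at `0` is the
quadratic polynomial in `t`. Since `2 |u| < α + β`, the product of the two sines outgrows the cosine
away from the real axis, so the integral tends to `0` as long as the circles keep away from the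
poles (`tendsto_circleIntegral_poleKernel`). This is the reason for the separated heights.

Larger `t` are reached by induction in steps of `α` (`tendsto_cotSum_step`). Passing from `t - α` to
`t` leaves one series unchanged and alters the other by two sawtooth series, while the count gains
the column `p = 0`; these changes agree. -/

/-! ### Fourier series of the sawtooth. -/

/-- Dirichlet's test gives convergence on the unit circle, and Abel's limit theorem identifies the
sum with the radial limit of the logarithm. -/
theorem tendsto_sum_pow_div {z : ℂ} (hz : ‖z‖ = 1) (hz1 : z ≠ 1) :
    Tendsto (fun n : ℕ => ∑ i ∈ Finset.range n, z ^ (i + 1) / ((i : ℂ) + 1)) atTop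
      (𝓝 (-Complex.log (1 - z))) := by
  have hre : 0 < (1 - z).re := by
    have h1 : z.re ≤ 1 := hz ▸ Complex.re_le_norm z
    rcases h1.lt_or_eq with h | h
    · simpa using h
    · exfalso
      apply hz1
      have h2 := Complex.sq_norm z
      rw [hz, Complex.normSq_apply, h] at h2
      apply Complex.ext
      · simpa using h
      · have : z.im * z.im = 0 := by linarith
        simpa using this
  have hslit : 1 - z ∈ Complex.slitPlane := Or.inl hre
  have hcauchy : CauchySeq fun n : ℕ =>
      ∑ i ∈ Finset.range n, (1 / ((i : ℝ) + 1)) • z ^ (i + 1) := by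
    -- The geometric sums `z (z ^ n - 1) / (z - 1)` are bounded by `2 / ‖z - 1‖`.
    refine Antitone.cauchySeq_series_mul_of_tendsto_zero_of_bounded
      (b := 2 / ‖z - 1‖) ?_ tendsto_one_div_add_atTop_nhds_zero_nat ?_
    · intro m n hmn
      exact one_div_le_one_div_of_le (by positivity) (by gcongr)
    · intro n
      have : ∑ i ∈ Finset.range n, z ^ (i + 1) = z * ((z ^ n - 1) / (z - 1)) := by
        rw [← geom_sum_eq hz1, Finset.mul_sum]
        exact Finset.sum_congr rfl fun i _ => pow_succ' z i
      rw [this, norm_mul, norm_div, hz, one_mul]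
      gcongr
      calc ‖z ^ n - 1‖ ≤ ‖z ^ n‖ + ‖(1 : ℂ)‖ := norm_sub_le _ _
        _ = 2 := by rw [norm_pow, hz]; norm_num
  obtain ⟨l, hl⟩ := cauchySeq_tendsto_of_complete hcauchy
  have hl' : Tendsto (fun n : ℕ => ∑ i ∈ Finset.range n, z ^ (i + 1) / ((i : ℂ) + 1)) atTop
      (𝓝 l) := by
    refine hl.congr fun n => Finset.sum_congr rfl fun i _ => ?_
    rw [Complex.real_smul]; push_cast; ring
  have habel := Complex.tendsto_tsum_powerSeries_nhdsWithin_lt hl'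
  rw [tendsto_map'_iff] at habel
  -- Abel's theorem concerns `∑ z ^ (i + 1) / (i + 1) * r ^ i`, one power of `r` short of the
  -- logarithm series; hence the division by `r`.
  have hlog : Tendsto (fun r : ℝ => -Complex.log (1 - r * z) / r) (𝓝[<] 1)
      (𝓝 (-Complex.log (1 - z))) := by
    have : ContinuousAt (fun r : ℝ => -Complex.log (1 - r * z) / (r : ℂ)) 1 := by
      refine ContinuousAt.div (ContinuousAt.neg (ContinuousAt.clog (by fun_prop) ?_))
        (by fun_prop) (by simp)
      simpa using hslit
    have h2 := this.tendsto
    simp only [Complex.ofReal_one, one_mul, div_one] at h2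
    exact h2.mono_left nhdsWithin_le_nhds
  have heq : l = -Complex.log (1 - z) := by
    refine tendsto_nhds_unique habel (hlog.congr' ?_)
    filter_upwards [Ioo_mem_nhdsLT (show (0 : ℝ) < 1 by norm_num)] with r hr
    have hr0 : (r : ℂ) ≠ 0 := by exact_mod_cast hr.1.ne'
    have hnorm : ‖(r : ℂ) * z‖ < 1 := by
      rw [norm_mul, hz, mul_one, Complex.norm_real, Real.norm_of_nonneg hr.1.le]
      exact hr.2
    have hs := Complex.hasSum_taylorSeries_neg_log hnorm
    -- The term of index `0` has denominator `0` and so is `0` by convention; removing it shifts the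
    -- index.
    rw [← hasSum_nat_add_iff' 1] at hs
    simp only [Finset.range_one, Finset.sum_singleton, Nat.cast_zero, div_zero, sub_zero] at hs
    have hs2 := (hs.div_const (r : ℂ)).tsum_eq
    rw [← hs2]
    refine tsum_congr fun n => ?_
    push_cast
    have : ((n : ℂ) + 1) ≠ 0 := Nat.cast_add_one_ne_zero n
    field_simp
    ring
  rwa [heq] at hl'

/-- Polar form: `1 - e ^ (iθ) = 2 sin (θ / 2) e ^ (i (θ - π) / 2)`, with positive modulus on this
range. -/
theorem arg_one_sub_exp {θ : ℝ} (h0 : 0 < θ) (h1 : θ < 2 * Real.pi) :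
    Complex.arg (1 - Complex.exp (θ * Complex.I)) = (θ - Real.pi) / 2 := by
  have hs : 0 < 2 * Real.sin (θ / 2) := by
    have := Real.sin_pos_of_pos_of_lt_pi (x := θ / 2) (by linarith) (by linarith)
    linarith
  have key : (1 : ℂ) - Complex.exp (θ * Complex.I) = ((2 * Real.sin (θ / 2) : ℝ) : ℂ) *
      (Complex.cos (((θ - Real.pi) / 2 : ℝ) : ℂ) +
        Complex.sin (((θ - Real.pi) / 2 : ℝ) : ℂ) * Complex.I) := by
    have e1 : Real.cos ((θ - Real.pi) / 2) = Real.sin (θ / 2) := by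
      rw [← Real.cos_pi_div_two_sub, ← Real.cos_neg]; congr 1; ring
    have e2 : Real.sin ((θ - Real.pi) / 2) = -Real.cos (θ / 2) := by
      rw [← Real.sin_pi_div_two_sub, ← Real.sin_neg]; congr 1; ring
    have hc : Real.cos θ = 1 - 2 * Real.sin (θ / 2) ^ 2 := by
      rw [← Real.cos_two_mul_eq_one_sub, mul_div_cancel₀ _ two_ne_zero]
    have hsn : Real.sin θ = 2 * Real.sin (θ / 2) * Real.cos (θ / 2) := by
      rw [← Real.sin_two_mul, mul_div_cancel₀ _ two_ne_zero]
    rw [Complex.exp_mul_I, ← Complex.ofReal_cos, ← Complex.ofReal_sin, ← Complex.ofReal_cos,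
      ← Complex.ofReal_sin, e1, e2, hc, hsn]
    push_cast
    ring
  rw [key]
  exact Complex.arg_mul_cos_add_sin_mul_I hs ⟨by linarith [Real.pi_pos], by linarith [Real.pi_pos]⟩

theorem bernoulliStar_intCast (n : ℤ) : bernoulliStar n = 0 := by
  simp [bernoulliStar]

theorem bernoulliStar_of_ne {y : ℝ} (hy : ∀ n : ℤ, y ≠ n) :
    bernoulliStar y = Int.fract y - 1 / 2 := by
  rw [bernoulliStar, if_neg]
  simpa using hy

theorem bernoulliStar_sub_one (y : ℝ) : bernoulliStar (y - 1) = bernoulliStar y := by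
  by_cases h : ∃ n : ℤ, y = n
  · obtain ⟨n, rfl⟩ := h
    rw [bernoulliStar_intCast, show (n : ℝ) - 1 = ((n - 1 : ℤ) : ℝ) by push_cast; ring,
      bernoulliStar_intCast]
  · push Not at h
    rw [bernoulliStar_of_ne h, bernoulliStar_of_ne, Int.fract_sub_one]
    intro n hn
    exact h (n + 1) (by push_cast; linarith)

/-- The Fourier series of the sawtooth function. -/
theorem tendsto_sum_sin_div (y : ℝ) :
    Tendsto (fun K : ℕ => ∑ k ∈ Finset.Icc 1 K, Real.sin (2 * Real.pi * k * y) / k) atTop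
      (𝓝 (-Real.pi * bernoulliStar y)) := by
  by_cases h : ∃ n : ℤ, y = n
  · obtain ⟨n, rfl⟩ := h
    rw [bernoulliStar_intCast, mul_zero]
    refine tendsto_const_nhds.congr fun K => (Finset.sum_eq_zero fun k _ => ?_).symm
    rw [show 2 * Real.pi * (k : ℝ) * (n : ℝ) = ((2 * k * n : ℤ) : ℝ) * Real.pi by
      push_cast; ring, Real.sin_int_mul_pi, zero_div]
  push Not at h
  have hf0 : 0 < Int.fract y :=
    (Int.fract_nonneg y).lt_of_ne' fun h0 => by
      obtain ⟨m, hm⟩ := Int.fract_eq_zero_iff.1 h0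
      exact h m hm.symm
  set θ : ℝ := 2 * Real.pi * Int.fract y with hθ
  have hθ0 : 0 < θ := by positivity
  have hθ1 : θ < 2 * Real.pi := by
    rw [hθ]; nlinarith [Int.fract_lt_one y, Real.pi_pos]
  have harg := arg_one_sub_exp hθ0 hθ1
  have hne : Complex.exp (θ * Complex.I) ≠ 1 := by
    intro h1
    rw [h1, sub_self, Complex.arg_zero] at harg
    rw [Complex.exp_eq_one_iff] at h1
    obtain ⟨m, hm⟩ := h1
    have : θ = m * (2 * Real.pi) := by
      have := congrArg Complex.im hm
      simpa using this
    have hp := Real.two_pi_pos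
    have h1 : (0 : ℝ) < m := by
      by_contra hc
      push Not at hc
      nlinarith
    have h2 : (m : ℝ) < 1 := by
      by_contra hc
      push Not at hc
      nlinarith
    have h1' : 0 < m := by exact_mod_cast h1
    have h2' : m < 1 := by exact_mod_cast h2
    omega
  have hlim := (Complex.continuous_im.tendsto _).comp
    (tendsto_sum_pow_div (Complex.norm_exp_ofReal_mul_I θ) hne)
  have hval : (-Complex.log (1 - Complex.exp (θ * Complex.I))).im =
      -Real.pi * bernoulliStar y := by
    rw [Complex.neg_im, Complex.log_im, harg, bernoulliStar_of_ne h, hθ]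
    ring
  rw [hval] at hlim
  refine hlim.congr fun K => ?_
  rw [Function.comp_apply, Complex.im_sum, Finset.range_eq_Ico,
    ← Finset.Ico_add_one_right_eq_Icc,
    ← Finset.sum_Ico_add' (fun k : ℕ => Real.sin (2 * Real.pi * k * y) / k) 0 K 1]
  refine Finset.sum_congr rfl fun i _ => ?_
  have hsin : Real.sin (2 * Real.pi * ((i + 1 : ℕ) : ℝ) * y) = Real.sin ((i + 1 : ℕ) * θ) := by
    rw [← Real.sin_add_int_mul_two_pi ((i + 1 : ℕ) * θ) ((i + 1 : ℕ) * ⌊y⌋), hθ]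
    congr 1
    conv_lhs => rw [← Int.floor_add_fract y]
    push_cast
    ring
  rw [hsin, ← Complex.exp_nat_mul, ← mul_assoc,
    show ((i + 1 : ℕ) : ℂ) * (θ : ℂ) = (((i + 1 : ℕ) * θ : ℝ) : ℂ) by push_cast; ring,
    show (i : ℂ) + 1 = (((i + 1 : ℕ) : ℝ) : ℂ) by push_cast; ring, Complex.div_ofReal_im,
    Complex.exp_ofReal_mul_I_im]

/-! ### Residue theorem for simple poles. -/

/-- A residue theorem for a disc and a function with finitely many simple poles. -/
theorem circleIntegral_eq_sum_residues {f r : ℂ → ℂ} {S : Finset ℂ} {R : ℝ} (hR : 0 < R)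
    (hS : ∀ w ∈ S, w ∈ Metric.ball (0 : ℂ) R)
    (hf : ∀ z ∈ Metric.closedBall (0 : ℂ) R, z ∉ S → DifferentiableAt ℂ f z)
    (hr : ∀ w ∈ S, Tendsto (fun z => (z - w) * f z) (𝓝[≠] w) (𝓝 (r w))) :
    (∮ z in C(0, R), f z) = 2 * Real.pi * Complex.I * ∑ w ∈ S, r w := by
  classical
  -- With the principal parts subtracted, every singularity becomes removable.
  set g : ℂ → ℂ := fun z => f z - ∑ w ∈ S, r w * (z - w)⁻¹ with hg
  have hgd : ∀ z ∈ Metric.closedBall (0 : ℂ) R, z ∉ S → DifferentiableAt ℂ g z := by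
    intro z hzR hz
    refine (hf z hzR hz).sub (DifferentiableAt.fun_sum fun w hw => ?_)
    have : z - w ≠ 0 := sub_ne_zero.2 fun h => hz (h ▸ hw)
    exact ((differentiableAt_id.sub_const w).inv this).const_mul (r w)
  have hpunct : ∀ w, ∀ᶠ z in 𝓝[≠] w, z ∉ S := by
    intro w
    have h1 : ∀ᶠ z in 𝓝 w, z ∉ S.erase w :=
      (S.erase w).finite_toSet.isClosed.isOpen_compl.mem_nhds (by simp)
    filter_upwards [h1.filter_mono nhdsWithin_le_nhds, self_mem_nhdsWithin] with z hz hzw hzS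
    exact hz (Finset.mem_erase.2 ⟨hzw, hzS⟩)
  have hzero : ∀ w ∈ S, Tendsto (fun z => (z - w) * g z) (𝓝[≠] w) (𝓝 0) := by
    intro w hw
    have h1 : Tendsto (fun z => (z - w) * f z - (r w + ∑ v ∈ S.erase w,
        (z - w) * (r v * (z - v)⁻¹))) (𝓝[≠] w)
        (𝓝 (r w - (r w + ∑ v ∈ S.erase w, (w - w) * (r v * (w - v)⁻¹)))) := by
      refine (hr w hw).sub (tendsto_const_nhds.add (tendsto_finsetSum _ fun v hv => ?_))
      have hv' : w - v ≠ 0 := sub_ne_zero.2 (Finset.ne_of_mem_erase hv).symm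
      have : ContinuousAt (fun z : ℂ => (z - w) * (r v * (z - v)⁻¹)) w := by
        refine ContinuousAt.mul (by fun_prop) (ContinuousAt.mul continuousAt_const ?_)
        exact ContinuousAt.inv₀ (by fun_prop) hv'
      exact this.tendsto.mono_left nhdsWithin_le_nhds
    simp only [sub_self, zero_mul, Finset.sum_const_zero, add_zero] at h1
    refine h1.congr' ?_
    filter_upwards [self_mem_nhdsWithin] with z hz
    have hzw : z - w ≠ 0 := sub_ne_zero.2 hz
    rw [hg]
    simp only
    rw [← Finset.add_sum_erase S _ hw, mul_sub, mul_add, Finset.mul_sum]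
    congr 2
    field_simp
  have hlim : ∀ w ∈ S, Tendsto g (𝓝[≠] w) (𝓝 (limUnder (𝓝[≠] w) g)) := by
    intro w hw
    refine Complex.tendsto_limUnder_of_differentiable_on_punctured_nhds_of_isLittleO
      ?_ ?_
    · filter_upwards [hpunct w, nhdsWithin_le_nhds (Metric.isOpen_ball.mem_nhds (hS w hw))]
        with z hz hzR
      exact hgd z (Metric.ball_subset_closedBall hzR) hz
    rw [Asymptotics.isLittleO_iff_tendsto']
    · have h1 : Tendsto (fun z => (z - w) * g w) (𝓝[≠] w) (𝓝 0) := by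
        have : ContinuousAt (fun z : ℂ => (z - w) * g w) w := by fun_prop
        simpa using this.tendsto.mono_left (nhdsWithin_le_nhds (s := {w}ᶜ))
      have h2 := (hzero w hw).sub h1
      rw [sub_zero] at h2
      refine h2.congr fun z => ?_
      rw [div_inv_eq_mul]
      ring
    · filter_upwards [self_mem_nhdsWithin] with z hz h0
      exact absurd (inv_eq_zero.1 h0) (sub_ne_zero.2 hz)
  -- `G` fills in the limits at the points of `S`. It is continuous on the disc and differentiable
  -- off a finite set, which is enough for Cauchy's theorem.
  set G : ℂ → ℂ := fun z => if z ∈ S then limUnder (𝓝[≠] z) g else g z with hG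
  have hGd : ∀ z ∈ Metric.closedBall (0 : ℂ) R, z ∉ S → DifferentiableAt ℂ G z := by
    intro z hzR hz
    refine (hgd z hzR hz).congr_of_eventuallyEq ?_
    filter_upwards [S.finite_toSet.isClosed.isOpen_compl.mem_nhds (show z ∈ (S : Set ℂ)ᶜ from hz)]
      with y hy
    exact if_neg hy
  have hGc : ContinuousOn G (Metric.closedBall 0 R) := by
    refine continuousOn_of_forall_continuousAt fun z hzR => ?_
    by_cases hz : z ∈ S
    · rw [continuousAt_iff_punctured_nhds]
      have : G z = limUnder (𝓝[≠] z) g := if_pos hz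
      rw [this]
      refine (hlim z hz).congr' ?_
      filter_upwards [hpunct z] with y hy
      exact (if_neg hy).symm
    · exact (hGd z hzR hz).continuousAt
  have hGint : (∮ z in C(0, R), G z) = 0 :=
    Complex.circleIntegral_eq_zero_of_differentiable_on_off_countable hR.le
      S.finite_toSet.countable hGc fun z hz => hGd z (Metric.ball_subset_closedBall hz.1) hz.2
  have hsphere : ∀ z ∈ Metric.sphere (0 : ℂ) R, z ∉ S := by
    intro z hz hzS
    have h1 := hS z hzS
    rw [Metric.mem_ball] at h1
    rw [Metric.mem_sphere] at hz
    exact h1.ne hz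
  have hdecomp : (∮ z in C(0, R), f z) =
      ∮ z in C(0, R), (G z + ∑ w ∈ S, r w * (z - w)⁻¹) := by
    refine circleIntegral.integral_congr hR.le fun z hz => ?_
    simp only [hG, hg, if_neg (hsphere z hz)]
    ring
  have hci : ∀ w ∈ S, CircleIntegrable (fun z => r w * (z - w)⁻¹) 0 R := by
    intro w hw
    refine ContinuousOn.circleIntegrable hR.le fun z hz => ?_
    have : z - w ≠ 0 := sub_ne_zero.2 fun h => hsphere z hz (h ▸ hw)
    have hc : ContinuousAt (fun z : ℂ => r w * (z - w)⁻¹) z :=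
      ContinuousAt.mul continuousAt_const (ContinuousAt.inv₀ (by fun_prop) this)
    exact hc.continuousWithinAt
  rw [hdecomp, circleIntegral.integral_add ((hGc.mono Metric.sphere_subset_closedBall).circleIntegrable hR.le)
    (CircleIntegrable.fun_sum S hci), hGint, zero_add, circleIntegral.integral_fun_sum hci,
    Finset.mul_sum]
  refine Finset.sum_congr rfl fun w hw => ?_
  rw [circleIntegral.integral_const_mul, circleIntegral.integral_sub_inv_of_mem_ball (hS w hw)]
  ring

/-! ### Growth of sine and cosine, and admissible radii. -/

theorem norm_sin_sq (w : ℂ) :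
    ‖Complex.sin w‖ ^ 2 = Real.sin w.re ^ 2 + Real.sinh w.im ^ 2 := by
  rw [Complex.sq_norm, Complex.normSq_apply]
  have h := Complex.sin_eq w
  rw [← Complex.ofReal_sin, ← Complex.ofReal_cos, ← Complex.ofReal_sinh,
    ← Complex.ofReal_cosh] at h
  have hre : (Complex.sin w).re = Real.sin w.re * Real.cosh w.im := by
    rw [h]
    simp [-Complex.ofReal_sin, -Complex.ofReal_cos, -Complex.ofReal_sinh, -Complex.ofReal_cosh]
  have him : (Complex.sin w).im = Real.cos w.re * Real.sinh w.im := by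
    rw [h]
    simp [-Complex.ofReal_sin, -Complex.ofReal_cos, -Complex.ofReal_sinh, -Complex.ofReal_cosh]
  rw [hre, him]
  have h1 := Real.cosh_sq w.im
  have h2 := Real.sin_sq_add_cos_sq w.re
  linear_combination Real.sin w.re ^ 2 * h1 + Real.sinh w.im ^ 2 * h2

theorem two_mul_le_abs_sin_pi_mul {x η : ℝ} (hη : ∀ n : ℤ, η ≤ |x - n|) :
    2 * η ≤ |Real.sin (Real.pi * x)| := by
  set y := x - round x with hy
  have hyr : |y| ≤ 1 / 2 := abs_sub_round x
  have h1 : |Real.sin (Real.pi * x)| = |Real.sin (Real.pi * y)| := by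
    rw [hy, mul_sub, mul_comm Real.pi (round x : ℝ), Real.sin_sub_int_mul_pi, abs_mul]
    simp [abs_zpow]
  have h2 : |Real.sin (Real.pi * y)| = Real.sin (Real.pi * |y|) := by
    rw [Real.abs_sin_eq_sin_abs_of_abs_le_pi, abs_mul, abs_of_pos Real.pi_pos]
    rw [abs_mul, abs_of_pos Real.pi_pos]
    nlinarith [Real.pi_pos]
  have h3 := Real.mul_le_sin (x := Real.pi * |y|) (by positivity) (by nlinarith [Real.pi_pos])
  rw [h1, h2]
  have h4 : 2 / Real.pi * (Real.pi * |y|) = 2 * |y| := by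
    field_simp
  have := hη (round x)
  linarith

/-- Far from the real axis `|sinh|` supplies the exponential. In the strip `|Im w| < δ / 2` the
exponential is bounded, and `Re w` is still `δ / 2` away from the integers, so the real sine is
bounded below. -/
theorem exists_lower_bound_norm_sin {δ : ℝ} (hδ : 0 < δ) :
    ∃ c : ℝ, 0 < c ∧ ∀ w : ℂ, (∀ n : ℤ, δ ≤ ‖w - n‖) →
      c * Real.exp (Real.pi * |w.im|) ≤ ‖Complex.sin (Real.pi * w)‖ := by
  have hπ := Real.pi_pos
  set c₁ : ℝ := (1 - Real.exp (-(Real.pi * δ))) / 2 with hc₁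
  set c₂ : ℝ := δ * Real.exp (-(Real.pi * (δ / 2))) with hc₂
  have hc₁0 : 0 < c₁ := by
    have : Real.exp (-(Real.pi * δ)) < 1 := by
      rw [← Real.exp_zero]; exact Real.exp_lt_exp.2 (by nlinarith)
    rw [hc₁]; linarith
  have hc₂0 : 0 < c₂ := by positivity
  refine ⟨min c₁ c₂, lt_min hc₁0 hc₂0, fun w hw => ?_⟩
  have hsq := norm_sin_sq (Real.pi * w)
  have hre : ((Real.pi : ℂ) * w).re = Real.pi * w.re := by simp
  have him : ((Real.pi : ℂ) * w).im = Real.pi * w.im := by simp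
  rw [hre, him] at hsq
  rcases le_or_gt (δ / 2) |w.im| with h | h
  · have h1 : c₁ * Real.exp (Real.pi * |w.im|) ≤ |Real.sinh (Real.pi * w.im)| := by
      rw [Real.abs_sinh, abs_mul, abs_of_pos hπ, Real.sinh_eq, hc₁]
      have h2 : Real.exp (-(Real.pi * |w.im|)) ≤
          Real.exp (-(Real.pi * δ)) * Real.exp (Real.pi * |w.im|) := by
        rw [← Real.exp_add]
        apply Real.exp_le_exp.2
        nlinarith
      linarith
    calc min c₁ c₂ * Real.exp (Real.pi * |w.im|) ≤ c₁ * Real.exp (Real.pi * |w.im|) := by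
          gcongr; exact min_le_left _ _
      _ ≤ |Real.sinh (Real.pi * w.im)| := h1
      _ ≤ ‖Complex.sin (Real.pi * w)‖ := by
          refine abs_le_of_sq_le_sq ?_ (norm_nonneg _)
          rw [hsq]
          exact le_add_of_nonneg_left (sq_nonneg _)
  · have h1 : δ ≤ |Real.sin (Real.pi * w.re)| := by
      have := two_mul_le_abs_sin_pi_mul (x := w.re) (η := δ / 2) fun n => by
        have h2 := Complex.norm_le_abs_re_add_abs_im (w - n)
        simp only [Complex.sub_re, Complex.intCast_re, Complex.sub_im, Complex.intCast_im,
          sub_zero] at h2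
        linarith [hw n]
      linarith
    calc min c₁ c₂ * Real.exp (Real.pi * |w.im|) ≤ c₂ * Real.exp (Real.pi * |w.im|) := by
          gcongr; exact min_le_right _ _
      _ ≤ c₂ * Real.exp (Real.pi * (δ / 2)) := by gcongr
      _ = δ := by rw [hc₂, mul_assoc, ← Real.exp_add]; simp
      _ ≤ |Real.sin (Real.pi * w.re)| := h1
      _ ≤ ‖Complex.sin (Real.pi * w)‖ := by
          refine abs_le_of_sq_le_sq ?_ (norm_nonneg _)
          rw [hsq]
          exact le_add_of_nonneg_right (sq_nonneg _)

theorem norm_cos_le_exp_abs_im (w : ℂ) : ‖Complex.cos w‖ ≤ Real.exp |w.im| := by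
  rw [Complex.cos, norm_div, Complex.norm_ofNat, div_le_iff₀ two_pos]
  refine (norm_add_le _ _).trans ?_
  rw [Complex.norm_exp, Complex.norm_exp]
  have h1 : (w * Complex.I).re = -w.im := by simp
  have h2 : (-w * Complex.I).re = w.im := by simp
  rw [h1, h2, mul_two]
  gcongr
  · exact neg_le_abs _
  · exact le_abs_self _

/-- The truncation heights at which `R * α` and `R * β` stay at distance `δ` from the integers. -/
def realHeights (α β δ : ℝ) : Set ℝ :=
  {R : ℝ | ∀ n : ℤ, δ ≤ |R * α - n| ∧ δ ≤ |R * β - n|}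

theorem exists_mem_realHeights {α β : ℝ} (hα : 0 < α) (hαβ : α ≤ β) (M : ℝ) :
    ∃ R ∈ realHeights α β (1 / 8), M ≤ R := by
  have hβ : 0 < β := hα.trans_le hαβ
  have frac : ∀ (m : ℤ) (y : ℝ), m + 1 / 8 ≤ y → y ≤ m + 7 / 8 → ∀ n : ℤ, 1 / 8 ≤ |y - n| := by
    intro m y h1 h2 n
    rcases le_or_gt n m with h | h
    · have : (n : ℝ) ≤ m := by exact_mod_cast h
      exact le_trans (by linarith) (le_abs_self _)
    · have : (m : ℝ) + 1 ≤ n := by exact_mod_cast h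
      exact le_trans (by linarith) (neg_le_abs _)
  obtain ⟨N, hN⟩ := exists_int_gt (M * α)
  -- If `R₁ β` lies within `1 / 8` of an integer, increasing the radius by `1 / (4 β)` moves `R β`
  -- by exactly `1 / 4`, and `R α` by at most `1 / 4` because `α ≤ β`. Both then stay `1 / 8` away
  -- from the integers.
  set R₁ : ℝ := (N + 1 / 4) / α with hR₁
  have hR₁α : R₁ * α = N + 1 / 4 := by rw [hR₁]; field_simp
  have hMR : M ≤ R₁ := by
    by_contra hc
    push Not at hc
    nlinarith
  by_cases h : ∀ n : ℤ, 1 / 8 ≤ |R₁ * β - n|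
  · exact ⟨R₁, fun n => ⟨frac N _ (by linarith) (by linarith) n, h n⟩, hMR⟩
  · push Not at h
    obtain ⟨m, hm⟩ := h
    rw [abs_lt] at hm
    have hq : 1 / (4 * β) * α ≤ 1 / 4 := by
      rw [div_mul_eq_mul_div, div_le_div_iff₀ (by positivity) (by norm_num)]
      linarith
    have hq0 : 0 < 1 / (4 * β) * α := by positivity
    have hb : (R₁ + 1 / (4 * β)) * β = R₁ * β + 1 / 4 := by field_simp
    refine ⟨R₁ + 1 / (4 * β), fun n => ⟨frac N _ ?_ ?_ n, frac m _ ?_ ?_ n⟩, ?_⟩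
    · rw [add_mul]; linarith
    · rw [add_mul]; linarith
    · rw [hb]; linarith
    · rw [hb]; linarith
    · have : 0 < 1 / (4 * β) := by positivity
      linarith

/-! ### The kernel and the decay of its contour integral. -/

/-- The integrand whose residues are the terms of the two series, with the triple pole at the
origin reduced to a simple one. -/
noncomputable def poleKernel (α β u : ℝ) (z : ℂ) : ℂ :=
  Complex.cos (2 * Real.pi * u * z) /
      (z * (Complex.sin (Real.pi * (α * z)) * Complex.sin (Real.pi * (β * z)))) -
    1 / (Real.pi ^ 2 * α * β * z ^ 3)

theorem poleKernel_comm (α β u : ℝ) : poleKernel α β u = poleKernel β α u := by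
  funext z
  rw [poleKernel, poleKernel, mul_comm (Complex.sin (Real.pi * (α * z))),
    mul_right_comm (_ : ℂ) (α : ℂ) (β : ℂ)]

theorem differentiableAt_poleKernel {α β u : ℝ} (hα : α ≠ 0) (hβ : β ≠ 0) {z : ℂ} (hz : z ≠ 0)
    (h1 : Complex.sin (Real.pi * (α * z)) ≠ 0) (h2 : Complex.sin (Real.pi * (β * z)) ≠ 0) :
    DifferentiableAt ℂ (poleKernel α β u) z := by
  have hπ : (Real.pi : ℂ) ≠ 0 := by exact_mod_cast Real.pi_ne_zero
  have hα' : (α : ℂ) ≠ 0 := by exact_mod_cast hα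
  have hβ' : (β : ℂ) ≠ 0 := by exact_mod_cast hβ
  unfold poleKernel
  refine DifferentiableAt.sub (DifferentiableAt.div ?_ ?_ (mul_ne_zero hz (mul_ne_zero h1 h2)))
    (DifferentiableAt.div ?_ ?_ ?_)
  · fun_prop
  · fun_prop
  · fun_prop
  · fun_prop
  · positivity

theorem mul_poleKernel {α β u : ℝ} {z : ℂ} (hz : z ≠ 0) :
    z * poleKernel α β u z = Complex.cos (2 * Real.pi * u * z) /
      (Complex.sin (Real.pi * (α * z)) * Complex.sin (Real.pi * (β * z))) -
      1 / (Real.pi ^ 2 * α * β * z ^ 2) := by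
  rw [poleKernel, mul_sub, mul_div_assoc', mul_div_mul_left _ _ hz, mul_one_div]
  congr 1
  rw [show (Real.pi : ℂ) ^ 2 * α * β * z ^ 3 = z * (Real.pi ^ 2 * α * β * z ^ 2) by ring,
    div_mul_eq_div_div, div_self hz]

/-- The factor `z` comes from `dz = i z dθ`. On a circle of admissible radius the points `α z` and
`β z` are at distance at least `δ` from the integers, so both sines obey
`exists_lower_bound_norm_sin`. -/
theorem norm_mul_poleKernel_le {α β u δ : ℝ} (hα : 0 < α) (hβ : 0 < β) (hδ : 0 < δ) :
    ∃ C : ℝ, 0 < C ∧ ∀ R ∈ realHeights α β δ, 0 < R → ∀ z : ℂ, ‖z‖ = R →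
      ‖z * poleKernel α β u z‖ ≤
        C * Real.exp (-((Real.pi * (α + β) - 2 * Real.pi * |u|) * |z.im|)) +
          1 / (Real.pi ^ 2 * α * β * R ^ 2) := by
  obtain ⟨c, hc, hsin⟩ := exists_lower_bound_norm_sin hδ
  have hπ := Real.pi_pos
  refine ⟨1 / (c * c), by positivity, fun R hR hR0 z hz => ?_⟩
  have hz0 : z ≠ 0 := by rw [← norm_pos_iff, hz]; exact hR0
  have hsep : ∀ γ : ℝ, 0 < γ → (∀ n : ℤ, δ ≤ |R * γ - n|) → ∀ n : ℤ, δ ≤ ‖(γ : ℂ) * z - n‖ := by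
    intro γ hγ h n
    have h1 := abs_norm_sub_norm_le ((γ : ℂ) * z) n
    rw [norm_mul, Complex.norm_real, Real.norm_of_nonneg hγ.le, hz, Complex.norm_intCast,
      mul_comm γ R] at h1
    refine le_trans ?_ h1
    have := h |n|
    push_cast at this
    exact this
  have h1 := hsin _ (hsep α hα fun n => (hR n).1)
  have h2 := hsin _ (hsep β hβ fun n => (hR n).2)
  have him : ∀ γ : ℝ, 0 < γ → |((γ : ℂ) * z).im| = γ * |z.im| := by
    intro γ hγ
    simp [abs_mul, abs_of_pos hγ]
  rw [him α hα] at h1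
  rw [him β hβ] at h2
  have h3 : ‖Complex.cos (2 * Real.pi * u * z)‖ ≤ Real.exp (2 * Real.pi * |u| * |z.im|) := by
    have := norm_cos_le_exp_abs_im (2 * Real.pi * u * z)
    have e : (2 * (Real.pi : ℂ) * u * z).im = 2 * Real.pi * u * z.im := by
      rw [show (2 * (Real.pi : ℂ) * u * z) = ((2 * Real.pi * u : ℝ) : ℂ) * z by push_cast; ring,
        Complex.im_ofReal_mul]
    rwa [e, abs_mul, abs_mul, abs_of_pos (by positivity : 0 < 2 * Real.pi)] at this
  rw [mul_poleKernel hz0]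
  refine (norm_sub_le _ _).trans (add_le_add ?_ (le_of_eq ?_))
  · rw [norm_div, norm_mul]
    calc _ ≤ Real.exp (2 * Real.pi * |u| * |z.im|) /
          ((c * Real.exp (Real.pi * (α * |z.im|))) * (c * Real.exp (Real.pi * (β * |z.im|)))) := by
          gcongr
      _ = _ := by
          rw [show -((Real.pi * (α + β) - 2 * Real.pi * |u|) * |z.im|) =
            2 * Real.pi * |u| * |z.im| - (Real.pi * (α * |z.im|) + Real.pi * (β * |z.im|)) by ring,
            Real.exp_sub, Real.exp_add]
          field_simp
  · simp [hz, abs_of_pos hα, abs_of_pos hβ]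

theorem countable_sin_eq_zero : {θ : ℝ | Real.sin θ = 0}.Countable := by
  refine (Set.countable_range fun n : ℤ => (n : ℝ) * Real.pi).mono fun θ hθ => ?_
  exact Real.sin_eq_zero_iff.1 hθ

/-- Dominated convergence in the angle: the integrand is bounded uniformly and decays exponentially
in `R |sin θ|`, up to a term of order `R⁻²`. Pointwise convergence fails to follow only where `sin θ
= 0`, a countable set. -/
theorem tendsto_circleIntegral_poleKernel {α β u δ : ℝ} (hα : 0 < α) (hβ : 0 < β) (hδ : 0 < δ)
    (hu : 2 * |u| < α + β) :
    Tendsto (fun R : ℝ => ∮ z in C(0, R), poleKernel α β u z)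
      (atTop ⊓ 𝓟 (realHeights α β δ)) (𝓝 0) := by
  obtain ⟨C, hC, hbound⟩ := norm_mul_poleKernel_le (u := u) hα hβ hδ
  have hπ := Real.pi_pos
  set κ := Real.pi * (α + β) - 2 * Real.pi * |u| with hκ
  have hκ0 : 0 < κ := by
    have := mul_lt_mul_of_pos_left hu hπ
    rw [hκ]; linarith
  have hnorm : ∀ R ∈ realHeights α β δ, 0 < R → ∀ θ : ℝ,
      ‖deriv (circleMap 0 R) θ • poleKernel α β u (circleMap 0 R θ)‖ ≤
        C * Real.exp (-(κ * |Real.sin θ| * R)) + 1 / (Real.pi ^ 2 * α * β * R ^ 2) := by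
    intro R hR hR0 θ
    have h1 := hbound R hR hR0 (circleMap 0 R θ) (by rw [norm_circleMap_zero, abs_of_pos hR0])
    have h2 : (circleMap 0 R θ).im = R * Real.sin θ := by
      simp [circleMap, Complex.exp_ofReal_mul_I_im]
    rw [h2, abs_mul, abs_of_pos hR0] at h1
    rw [deriv_circleMap, smul_eq_mul, mul_right_comm, norm_mul, Complex.norm_I, mul_one]
    refine h1.trans (le_of_eq ?_)
    congr 3
    ring
  have hev : ∀ᶠ R in atTop ⊓ 𝓟 (realHeights α β δ), R ∈ realHeights α β δ ∧ 1 ≤ R :=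
    Eventually.and (mem_inf_of_right (mem_principal_self _))
      ((eventually_ge_atTop (1 : ℝ)).filter_mono inf_le_left)
  have hlim := intervalIntegral.tendsto_integral_filter_of_dominated_convergence
    (μ := MeasureTheory.volume) (a := 0) (b := 2 * Real.pi)
    (l := atTop ⊓ 𝓟 (realHeights α β δ)) (f := fun _ => (0 : ℂ))
    (F := fun R θ => deriv (circleMap 0 R) θ • poleKernel α β u (circleMap 0 R θ))
    (fun _ => C + 1 / (Real.pi ^ 2 * α * β)) ?_ ?_ intervalIntegrable_const ?_
  · simpa [circleIntegral] using hlim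
  · refine Eventually.of_forall fun R => Measurable.aestronglyMeasurable ?_
    simp only [deriv_circleMap]
    have hm : Measurable (circleMap 0 R) := (continuous_circleMap 0 R).measurable
    have hk : Measurable (poleKernel α β u) := by
      unfold poleKernel
      refine Measurable.sub (Measurable.div ?_ ?_) (Measurable.div ?_ ?_)
      · exact Continuous.measurable (by fun_prop)
      · exact Continuous.measurable (by fun_prop)
      · exact Continuous.measurable (by fun_prop)
      · exact Continuous.measurable (by fun_prop)
    exact (hm.mul_const _).smul (hk.comp hm)
  · filter_upwards [hev] with R hR
    refine Eventually.of_forall fun θ _ => (hnorm R hR.1 (by linarith [hR.2]) θ).trans ?_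
    have hR1 : 1 ≤ R := hR.2
    refine add_le_add ?_ (one_div_le_one_div_of_le (by positivity) ?_)
    · refine mul_le_of_le_one_right hC.le (Real.exp_le_one_iff.2 ?_)
      have : 0 ≤ κ * |Real.sin θ| * R := by positivity
      linarith
    · exact le_mul_of_one_le_right (by positivity) (one_le_pow₀ hR1)
  · have hae : ∀ᵐ θ : ℝ, Real.sin θ ≠ 0 :=
      MeasureTheory.compl_mem_ae_iff.2 (countable_sin_eq_zero.measure_zero _)
    filter_upwards [hae] with θ hθ _
    have hs : 0 < κ * |Real.sin θ| := mul_pos hκ0 (abs_pos.2 hθ)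
    have hz : Tendsto (fun R : ℝ => C * Real.exp (-(κ * |Real.sin θ| * R)) +
        1 / (Real.pi ^ 2 * α * β * R ^ 2)) atTop (𝓝 (C * 0 + 0)) := by
      refine Tendsto.add (Tendsto.const_mul _ ?_) ?_
      · exact Real.tendsto_exp_neg_atTop_nhds_zero.comp (tendsto_id.const_mul_atTop hs)
      · refine tendsto_const_nhds.div_atTop ((tendsto_pow_atTop two_ne_zero).const_mul_atTop ?_)
        positivity
    rw [mul_zero, add_zero] at hz
    refine squeeze_zero_norm' ?_ (hz.mono_left inf_le_left)
    filter_upwards [hev] with R hR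
    exact hnorm R hR.1 (by linarith [hR.2]) θ

/-! ### Local expansions and residues. -/

theorem tendsto_cos_sub_one_div_sq :
    Tendsto (fun w : ℂ => (Complex.cos w - 1) / w ^ 2) (𝓝[≠] 0) (𝓝 (-1 / 2)) := by
  rw [tendsto_iff_norm_sub_tendsto_zero]
  have h0 : Tendsto (fun w : ℂ => ‖w‖ ^ 2 * (5 / 96)) (𝓝[≠] 0) (𝓝 0) := by
    have : ContinuousAt (fun w : ℂ => ‖w‖ ^ 2 * (5 / 96 : ℝ)) 0 := by fun_prop
    simpa using this.tendsto.mono_left (nhdsWithin_le_nhds (s := {0}ᶜ))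
  refine squeeze_zero' (Eventually.of_forall fun _ => norm_nonneg _) ?_ h0
  filter_upwards [self_mem_nhdsWithin, nhdsWithin_le_nhds (Metric.closedBall_mem_nhds 0 one_pos)]
    with w hw hw1
  have hw0 : w ≠ 0 := hw
  have hb := Complex.cos_bound (x := w) (by simpa using hw1)
  have e : (Complex.cos w - 1) / w ^ 2 - -1 / 2 = (Complex.cos w - (1 - w ^ 2 / 2)) / w ^ 2 := by
    field_simp
    ring
  rw [e, norm_div, norm_pow, div_le_iff₀ (by positivity)]
  linarith

theorem tendsto_sin_div_sub_one_div_sq :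
    Tendsto (fun w : ℂ => (Complex.sin w / w - 1) / w ^ 2) (𝓝[≠] 0) (𝓝 (-1 / 6)) := by
  rw [tendsto_iff_norm_sub_tendsto_zero]
  have h0 : Tendsto (fun w : ℂ => ‖w‖ ^ 2 / 100) (𝓝[≠] 0) (𝓝 0) := by
    have : ContinuousAt (fun w : ℂ => ‖w‖ ^ 2 / (100 : ℝ)) 0 := by fun_prop
    simpa using this.tendsto.mono_left (nhdsWithin_le_nhds (s := {0}ᶜ))
  refine squeeze_zero' (Eventually.of_forall fun _ => norm_nonneg _) ?_ h0
  filter_upwards [self_mem_nhdsWithin, nhdsWithin_le_nhds (Metric.closedBall_mem_nhds 0 one_pos)]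
    with w hw hw1
  have hw0 : w ≠ 0 := hw
  have hb := Complex.sin_bound (x := w) (by simpa using hw1)
  have e : (Complex.sin w / w - 1) / w ^ 2 - -1 / 6 =
      (Complex.sin w - (w - w ^ 3 / 6)) / w ^ 3 := by
    field_simp
    ring
  rw [e, norm_div, norm_pow, div_le_iff₀ (by positivity)]
  refine hb.trans (le_of_eq ?_)
  ring

theorem tendsto_const_mul_punctured {A : ℂ} (hA : A ≠ 0) :
    Tendsto (fun z : ℂ => A * z) (𝓝[≠] 0) (𝓝[≠] 0) := by
  refine tendsto_nhdsWithin_of_tendsto_nhds_of_eventually_within _ ?_ ?_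
  · have : ContinuousAt (fun z : ℂ => A * z) 0 := by fun_prop
    simpa using this.tendsto.mono_left (nhdsWithin_le_nhds (s := {0}ᶜ))
  · filter_upwards [self_mem_nhdsWithin] with z hz
    exact mul_ne_zero hA hz

/-- The Laurent coefficient at the origin of `cos (c z) / (sin (A z) sin (B z))`. -/
theorem tendsto_cos_div_sin_mul_sin {A B c : ℂ} (hA : A ≠ 0) (hB : B ≠ 0) (hc : c ≠ 0) :
    Tendsto (fun z : ℂ => Complex.cos (c * z) / (Complex.sin (A * z) * Complex.sin (B * z)) -
      1 / (A * B * z ^ 2)) (𝓝[≠] 0) (𝓝 ((A ^ 2 / 6 + B ^ 2 / 6 - c ^ 2 / 2) / (A * B))) := by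
  -- `σ` and `τ` are the second-order remainders of `sin w / w` and `cos w`. Written through them,
  -- the double pole cancels algebraically and only their limits `-1 / 6` and `-1 / 2` matter.
  set σ : ℂ → ℂ := fun w => (Complex.sin w / w - 1) / w ^ 2 with hσ
  set τ : ℂ → ℂ := fun w => (Complex.cos w - 1) / w ^ 2 with hτ
  have hsA := tendsto_sin_div_sub_one_div_sq.comp (tendsto_const_mul_punctured hA)
  have hsB := tendsto_sin_div_sub_one_div_sq.comp (tendsto_const_mul_punctured hB)
  have hcc := tendsto_cos_sub_one_div_sq.comp (tendsto_const_mul_punctured hc)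
  change Tendsto (fun z => σ (A * z)) _ _ at hsA
  change Tendsto (fun z => σ (B * z)) _ _ at hsB
  change Tendsto (fun z => τ (c * z)) _ _ at hcc
  have hz : Tendsto (fun z : ℂ => z ^ 2) (𝓝[≠] 0) (𝓝 0) := by
    have : ContinuousAt (fun z : ℂ => z ^ 2) 0 := by fun_prop
    simpa using this.tendsto.mono_left (nhdsWithin_le_nhds (s := {0}ᶜ))
  have hdA : Tendsto (fun z : ℂ => 1 + A ^ 2 * z ^ 2 * σ (A * z)) (𝓝[≠] 0) (𝓝 1) := by
    simpa using ((hz.const_mul (A ^ 2)).mul hsA).const_add 1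
  have hdB : Tendsto (fun z : ℂ => 1 + B ^ 2 * z ^ 2 * σ (B * z)) (𝓝[≠] 0) (𝓝 1) := by
    simpa using ((hz.const_mul (B ^ 2)).mul hsB).const_add 1
  have hnum : Tendsto (fun z : ℂ => c ^ 2 * τ (c * z) - A ^ 2 * σ (A * z) - B ^ 2 * σ (B * z) -
      A ^ 2 * B ^ 2 * z ^ 2 * (σ (A * z) * σ (B * z))) (𝓝[≠] 0)
      (𝓝 (c ^ 2 * (-1 / 2) - A ^ 2 * (-1 / 6) - B ^ 2 * (-1 / 6) -
        A ^ 2 * B ^ 2 * 0 * (-1 / 6 * (-1 / 6)))) :=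
    (((hcc.const_mul _).sub (hsA.const_mul _)).sub (hsB.const_mul _)).sub
      ((hz.const_mul _).mul (hsA.mul hsB))
  have hall := hnum.div ((tendsto_const_nhds (x := A * B)).mul (hdA.mul hdB)) (by simp [hA, hB])
  have hval : (c ^ 2 * (-1 / 2) - A ^ 2 * (-1 / 6) - B ^ 2 * (-1 / 6) -
        A ^ 2 * B ^ 2 * 0 * (-1 / 6 * (-1 / 6))) / (A * B * (1 * 1)) =
      (A ^ 2 / 6 + B ^ 2 / 6 - c ^ 2 / 2) / (A * B) := by
    congr 1 <;> ring
  rw [hval] at hall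
  refine hall.congr' ?_
  filter_upwards [self_mem_nhdsWithin, hdA.eventually_ne one_ne_zero,
    hdB.eventually_ne one_ne_zero] with z hz0 h1 h2
  have hz0 : z ≠ 0 := hz0
  have eA : Complex.sin (A * z) = A * z * (1 + A ^ 2 * z ^ 2 * σ (A * z)) := by
    simp only [hσ]; field_simp; ring
  have eB : Complex.sin (B * z) = B * z * (1 + B ^ 2 * z ^ 2 * σ (B * z)) := by
    simp only [hσ]; field_simp; ring
  have ec : Complex.cos (c * z) = 1 + c ^ 2 * z ^ 2 * τ (c * z) := by
    simp only [hτ]; field_simp; ring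
  simp only [Pi.div_apply]
  rw [eA, eB, ec]
  generalize σ (A * z) = p at *
  generalize σ (B * z) = q at *
  generalize τ (c * z) = s at *
  rw [div_sub_div _ _ (mul_ne_zero (mul_ne_zero (mul_ne_zero hA hz0) h1)
    (mul_ne_zero (mul_ne_zero hB hz0) h2)) (by positivity),
    div_eq_div_iff (mul_ne_zero (mul_ne_zero hA hB) (mul_ne_zero h1 h2))
      (mul_ne_zero (mul_ne_zero (mul_ne_zero (mul_ne_zero hA hz0) h1)
        (mul_ne_zero (mul_ne_zero hB hz0) h2)) (by positivity))]
  ring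

theorem tendsto_mul_poleKernel_zero {α β u : ℝ} (hα : α ≠ 0) (hβ : β ≠ 0) (hu : u ≠ 0) :
    Tendsto (fun z : ℂ => (z - 0) * poleKernel α β u z) (𝓝[≠] 0)
      (𝓝 ((((α ^ 2 + β ^ 2) / 6 - 2 * u ^ 2) / (α * β) : ℝ) : ℂ)) := by
  have hπ : (Real.pi : ℂ) ≠ 0 := by exact_mod_cast Real.pi_ne_zero
  have hα' : (α : ℂ) ≠ 0 := by exact_mod_cast hα
  have hβ' : (β : ℂ) ≠ 0 := by exact_mod_cast hβ
  have hu' : (u : ℂ) ≠ 0 := by exact_mod_cast hu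
  have h := tendsto_cos_div_sin_mul_sin (mul_ne_zero hπ hα') (mul_ne_zero hπ hβ')
    (mul_ne_zero (mul_ne_zero two_ne_zero hπ) hu')
  have hval : (((Real.pi : ℂ) * α) ^ 2 / 6 + (Real.pi * β) ^ 2 / 6 - (2 * Real.pi * u) ^ 2 / 2) /
      (Real.pi * α * (Real.pi * β)) =
      ((((α ^ 2 + β ^ 2) / 6 - 2 * u ^ 2) / (α * β) : ℝ) : ℂ) := by
    push_cast
    field_simp
  rw [hval] at h
  refine h.congr' ?_
  filter_upwards [self_mem_nhdsWithin] with z hz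
  rw [sub_zero, mul_poleKernel hz]
  congr 2
  · simp only [mul_assoc]
  · ring

theorem sin_pi_mul_div_ne_zero {α β : ℝ} (hαβ : Irrational (β / α)) {k : ℤ} (hk : k ≠ 0) :
    Real.sin (Real.pi * k * β / α) ≠ 0 := by
  intro h
  obtain ⟨n, hn⟩ := Real.sin_eq_zero_iff.1 h
  have h1 : (n : ℝ) = k * (β / α) := by
    have : (n : ℝ) * Real.pi = (k * (β / α)) * Real.pi := by rw [hn]; ring
    exact mul_right_cancel₀ Real.pi_ne_zero this
  exact (hαβ.intCast_mul hk).ne_int n h1.symm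

theorem tendsto_mul_poleKernel_pole {α β u : ℝ} (hα : 0 < α) (hβ : 0 < β)
    (hαβ : Irrational (β / α)) {k : ℤ} (hk : k ≠ 0) :
    Tendsto (fun z : ℂ => (z - ((k / α : ℝ) : ℂ)) * poleKernel α β u z)
      (𝓝[≠] ((k / α : ℝ) : ℂ))
      (𝓝 ((Real.cos (2 * Real.pi * u * (k / α)) * Real.cos (Real.pi * k) /
        (Real.pi * k * Real.sin (Real.pi * k * β / α)) : ℝ) : ℂ)) := by
  set w : ℂ := ((k / α : ℝ) : ℂ) with hw
  have hπ : (Real.pi : ℂ) ≠ 0 := by exact_mod_cast Real.pi_ne_zero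
  have hα' : (α : ℂ) ≠ 0 := by exact_mod_cast hα.ne'
  have hβ' : (β : ℂ) ≠ 0 := by exact_mod_cast hβ.ne'
  have hk' : (k : ℂ) ≠ 0 := by exact_mod_cast hk
  have hαw : (α : ℂ) * w = k := by rw [hw]; push_cast; field_simp
  have hw0 : w ≠ 0 := by rintro h; rw [h, mul_zero] at hαw; exact hk' hαw.symm
  have hsβ : Complex.sin (Real.pi * (β * w)) = ((Real.sin (Real.pi * k * β / α) : ℝ) : ℂ) := by
    rw [hw]; push_cast; congr 1; ring
  have hsβ0 : Complex.sin (Real.pi * (β * w)) ≠ 0 := by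
    rw [hsβ]; exact_mod_cast sin_pi_mul_div_ne_zero hαβ hk
  have hcos : Complex.cos (Real.pi * (α * w)) = ((Real.cos (Real.pi * k) : ℝ) : ℂ) := by
    rw [hαw]; push_cast; rfl
  have hsin0 : Complex.sin (Real.pi * (α * w)) = 0 := by
    rw [hαw, mul_comm, Complex.sin_int_mul_pi]
  -- As `cos (π k) = ±1`, it equals its own inverse; this moves it from the derivative in the
  -- denominator to the numerator of the residue.
  have hcsq : Real.cos (Real.pi * k) * Real.cos (Real.pi * k) = 1 := by
    have h1 := Real.sin_sq_add_cos_sq (Real.pi * k)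
    rw [mul_comm Real.pi, Real.sin_int_mul_pi] at h1
    rw [mul_comm Real.pi]
    nlinarith
  have hc0 : Real.cos (Real.pi * k) ≠ 0 := left_ne_zero_of_mul_eq_one hcsq
  have hder : HasDerivAt (fun z : ℂ => Complex.sin (Real.pi * (α * z)))
      (Complex.cos (Real.pi * (α * w)) * (Real.pi * α)) w := by
    have h1 : HasDerivAt (fun z : ℂ => (Real.pi : ℂ) * (α * z)) (Real.pi * (α * 1)) w :=
      ((hasDerivAt_id w).const_mul _).const_mul _
    rw [mul_one] at h1
    exact h1.csin
  have hslope := hder.tendsto_slope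
  rw [hcos] at hslope
  have hne : ((Real.cos (Real.pi * k) : ℝ) : ℂ) * (Real.pi * α) ≠ 0 :=
    mul_ne_zero (by exact_mod_cast hc0) (mul_ne_zero hπ hα')
  have hinv := hslope.inv₀ hne
  have hrest : ContinuousAt (fun z : ℂ => Complex.cos (2 * Real.pi * u * z) /
      (z * Complex.sin (Real.pi * (β * z)))) w :=
    ContinuousAt.div (by fun_prop) (by fun_prop) (mul_ne_zero hw0 hsβ0)
  have hlast : ContinuousAt (fun z : ℂ => (z - w) * (1 / (Real.pi ^ 2 * α * β * z ^ 3))) w := by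
    refine ContinuousAt.mul (by fun_prop) (ContinuousAt.div (by fun_prop) (by fun_prop) ?_)
    positivity
  have h := (hinv.mul (hrest.tendsto.mono_left nhdsWithin_le_nhds)).sub
    (hlast.tendsto.mono_left nhdsWithin_le_nhds)
  have hval : (((Real.cos (Real.pi * k) : ℝ) : ℂ) * (Real.pi * α))⁻¹ *
      (Complex.cos (2 * Real.pi * u * w) / (w * Complex.sin (Real.pi * (β * w)))) -
      (w - w) * (1 / (Real.pi ^ 2 * α * β * w ^ 3)) =
      ((Real.cos (2 * Real.pi * u * (k / α)) * Real.cos (Real.pi * k) /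
        (Real.pi * k * Real.sin (Real.pi * k * β / α)) : ℝ) : ℂ) := by
    have e1 : Complex.cos (2 * Real.pi * u * w) =
        ((Real.cos (2 * Real.pi * u * (k / α)) : ℝ) : ℂ) := by
      rw [hw]; push_cast; rfl
    rw [hsβ, e1, hw, sub_self, zero_mul, sub_zero]
    norm_cast
    have := sin_pi_mul_div_ne_zero hαβ hk
    have hkr : (k : ℝ) ≠ 0 := by exact_mod_cast hk
    have hinvc : (Real.cos (Real.pi * k))⁻¹ = Real.cos (Real.pi * k) :=
      inv_eq_of_mul_eq_one_left hcsq
    rw [mul_inv, hinvc]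
    field_simp
  rw [hval] at h
  refine h.congr' ?_
  filter_upwards [self_mem_nhdsWithin] with z hz
  have hzw : z - w ≠ 0 := sub_ne_zero.2 hz
  rw [poleKernel, slope_def_field, hsin0, sub_zero, mul_sub]
  congr 1
  rw [inv_div]
  ring

/-- The residue of `poleKernel α β u` at `k / α`. -/
noncomputable def poleResidue (α β u : ℝ) (k : ℤ) : ℝ :=
  Real.cos (2 * Real.pi * u * (k / α)) * Real.cos (Real.pi * k) /
    (Real.pi * k * Real.sin (Real.pi * k * β / α))

theorem poleResidue_neg (α β u : ℝ) (k : ℤ) : poleResidue α β u (-k) = poleResidue α β u k := by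
  unfold poleResidue
  push_cast
  rw [show 2 * Real.pi * u * (-(k : ℝ) / α) = -(2 * Real.pi * u * (k / α)) by ring,
    show Real.pi * -(k : ℝ) = -(Real.pi * k) by ring,
    show -(Real.pi * k) * β / α = -(Real.pi * k * β / α) by ring, Real.cos_neg, Real.cos_neg,
    Real.sin_neg, neg_mul_neg]

/-- The nonzero integers of absolute value at most `K`. -/
noncomputable def nonzeroIntegers (K : ℕ) : Finset ℤ := (Finset.Icc (-(K : ℤ)) K).erase 0

theorem mem_nonzeroIntegers {K : ℕ} {k : ℤ} : k ∈ nonzeroIntegers K ↔ k ≠ 0 ∧ |k| ≤ K := by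
  rw [nonzeroIntegers, Finset.mem_erase, Finset.mem_Icc, abs_le]

theorem sum_nonzeroIntegers {f : ℤ → ℝ} (hf : ∀ k, f (-k) = f k) (K : ℕ) :
    ∑ k ∈ nonzeroIntegers K, f k = 2 * ∑ k ∈ Finset.Icc 1 K, f (k : ℕ) := by
  induction K with
  | zero => simp [nonzeroIntegers]
  | succ K ih =>
    have h : nonzeroIntegers (K + 1) =
        insert ((K : ℤ) + 1) (insert (-((K : ℤ) + 1)) (nonzeroIntegers K)) := by
      ext k
      simp only [Finset.mem_insert, mem_nonzeroIntegers, abs_le]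
      push_cast
      omega
    rw [h, Finset.sum_insert, Finset.sum_insert, ih, Finset.sum_Icc_succ_top (by omega), hf]
    · push_cast
      ring
    · simp only [mem_nonzeroIntegers, abs_le]
      omega
    · simp only [Finset.mem_insert, mem_nonzeroIntegers, abs_le]
      omega

/-! ### Summing the residues. -/

theorem circleIntegral_poleKernel {α β u δ R : ℝ} (hα : 0 < α) (hβ : 0 < β)
    (hαβ : Irrational (β / α)) (hu : u ≠ 0) (hδ : 0 < δ) (hR0 : 0 < R)
    (hR : R ∈ realHeights α β δ) :
    (∮ z in C(0, R), poleKernel α β u z) = 2 * Real.pi * Complex.I *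
      (((((α ^ 2 + β ^ 2) / 6 - 2 * u ^ 2) / (α * β) +
        (2 * ∑ k ∈ Finset.Icc 1 ⌊R * α⌋₊, poleResidue α β u (k : ℕ) +
          2 * ∑ k ∈ Finset.Icc 1 ⌊R * β⌋₊, poleResidue β α u (k : ℕ)) : ℝ)) : ℂ) := by
  classical
  have hβα : Irrational (α / β) := by
    rw [← inv_div]; exact hαβ.inv
  set p : ℝ → ℤ → ℂ := fun γ k => ((k / γ : ℝ) : ℂ) with hp
  have hinj : ∀ γ : ℝ, 0 < γ → Function.Injective (p γ) := by
    intro γ hγ k l hkl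
    have h1 : (k : ℝ) / γ = l / γ := Complex.ofReal_injective hkl
    have h2 : (k : ℝ) = l := by
      field_simp at h1
      exact h1
    exact_mod_cast h2
  set P : ℝ → Finset ℂ := fun γ => (nonzeroIntegers ⌊R * γ⌋₊).image (p γ) with hP
  set S : Finset ℂ := insert 0 (P α ∪ P β) with hS
  have h0 : ∀ γ : ℝ, 0 < γ → (0 : ℂ) ∉ P γ := by
    intro γ hγ h
    obtain ⟨k, hk, hk0⟩ := Finset.mem_image.1 h
    refine (mem_nonzeroIntegers.1 hk).1 (hinj γ hγ ?_)
    rw [hk0]; simp [hp]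
  -- A common point `k / α = l / β` would make `k β / α` an integer, so irrationality keeps all
  -- nonzero poles simple.
  have hdisj : Disjoint (P α) (P β) := by
    rw [Finset.disjoint_left]
    intro z hz1 hz2
    obtain ⟨k, hk, rfl⟩ := Finset.mem_image.1 hz1
    obtain ⟨l, hl, hkl⟩ := Finset.mem_image.1 hz2
    have hk0 := (mem_nonzeroIntegers.1 hk).1
    have h1 : (l : ℝ) / β = k / α := Complex.ofReal_injective hkl
    refine (hαβ.intCast_mul hk0).ne_int l ?_
    field_simp at h1 ⊢
    linarith
  have hball : ∀ γ : ℝ, 0 < γ → (∀ n : ℤ, δ ≤ |R * γ - n|) → ∀ w ∈ P γ,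
      w ∈ Metric.ball (0 : ℂ) R := by
    intro γ hγ h w hw
    obtain ⟨k, hk, rfl⟩ := Finset.mem_image.1 hw
    have h1 : ((|k| : ℤ) : ℝ) ≤ ⌊R * γ⌋₊ := by exact_mod_cast (mem_nonzeroIntegers.1 hk).2
    have h2 : ((|k| : ℤ) : ℝ) ≤ R * γ := h1.trans (Nat.floor_le (by positivity))
    have h3 : ((|k| : ℤ) : ℝ) ≠ R * γ := by
      intro he
      have := h |k|
      rw [he, sub_self, abs_zero] at this
      linarith
    have h4 := lt_of_le_of_ne h2 h3
    rw [mem_ball_zero_iff, hp]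
    simp only
    rw [Complex.norm_real, Real.norm_eq_abs, abs_div, abs_of_pos hγ, div_lt_iff₀ hγ]
    simpa using h4
  have hpole : ∀ γ : ℝ, 0 < γ → ∀ z ∈ Metric.closedBall (0 : ℂ) R, z ≠ 0 →
      Complex.sin (Real.pi * (γ * z)) = 0 → z ∈ P γ := by
    intro γ hγ z hz hz0 hs
    have hγ' : (γ : ℂ) ≠ 0 := by exact_mod_cast hγ.ne'
    obtain ⟨k, hk⟩ := Complex.sin_eq_zero_iff.1 hs
    have h1 : (γ : ℂ) * z = k := by
      rw [mul_comm (k : ℂ)] at hk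
      exact mul_left_cancel₀ (by exact_mod_cast Real.pi_ne_zero) hk
    have h2 : z = p γ k := by
      simp only [hp]
      push_cast
      field_simp
      linear_combination h1
    refine Finset.mem_image.2 ⟨k, mem_nonzeroIntegers.2 ⟨?_, ?_⟩, h2.symm⟩
    · rintro rfl
      apply hz0
      rw [h2]; simp [hp]
    · have h3 : |(k : ℝ)| ≤ R * γ := by
        have h4 := congrArg norm h1
        rw [norm_mul, Complex.norm_real, Real.norm_of_nonneg hγ.le, Complex.norm_intCast] at h4
        rw [← h4, mul_comm]
        gcongr
        simpa using hz
      have h5 : ((k.natAbs : ℕ) : ℝ) ≤ R * γ := by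
        rw [Nat.cast_natAbs]; simpa using h3
      have := Nat.le_floor h5
      rw [Int.abs_eq_natAbs]
      omega
  -- Taking residues as limits gives one function for all three families of poles; the values are
  -- read off by `limUnder_eq` at the end.
  set r : ℂ → ℂ := fun w => limUnder (𝓝[≠] w) fun z => (z - w) * poleKernel α β u z with hr
  have hrα : ∀ k : ℤ, k ≠ 0 → Tendsto (fun z : ℂ => (z - p α k) * poleKernel α β u z)
      (𝓝[≠] (p α k)) (𝓝 ((poleResidue α β u k : ℝ) : ℂ)) := fun k hk =>
    tendsto_mul_poleKernel_pole hα hβ hαβ hk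
  have hrβ : ∀ k : ℤ, k ≠ 0 → Tendsto (fun z : ℂ => (z - p β k) * poleKernel α β u z)
      (𝓝[≠] (p β k)) (𝓝 ((poleResidue β α u k : ℝ) : ℂ)) := fun k hk => by
    rw [poleKernel_comm]
    exact tendsto_mul_poleKernel_pole hβ hα hβα hk
  have hr0 := tendsto_mul_poleKernel_zero hα.ne' hβ.ne' hu
  have hres : ∀ w ∈ S, Tendsto (fun z => (z - w) * poleKernel α β u z) (𝓝[≠] w) (𝓝 (r w)) := by
    intro w hw
    refine tendsto_nhds_limUnder ?_
    rcases Finset.mem_insert.1 hw with rfl | hw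
    · exact ⟨_, hr0⟩
    rcases Finset.mem_union.1 hw with hw | hw
    · obtain ⟨k, hk, rfl⟩ := Finset.mem_image.1 hw
      exact ⟨_, hrα k (mem_nonzeroIntegers.1 hk).1⟩
    · obtain ⟨k, hk, rfl⟩ := Finset.mem_image.1 hw
      exact ⟨_, hrβ k (mem_nonzeroIntegers.1 hk).1⟩
  rw [circleIntegral_eq_sum_residues (S := S) hR0 ?_ ?_ hres]
  · congr 1
    rw [hS, Finset.sum_insert (by simp [h0 α hα, h0 β hβ]), Finset.sum_union hdisj, hP]
    simp only
    rw [Finset.sum_image (hinj α hα).injOn, Finset.sum_image (hinj β hβ).injOn,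
      ← sum_nonzeroIntegers (poleResidue_neg α β u), ← sum_nonzeroIntegers (poleResidue_neg β α u),
      Complex.ofReal_add, Complex.ofReal_add, Complex.ofReal_sum, Complex.ofReal_sum]
    congr 1
    · exact hr0.limUnder_eq
    congr 1
    · exact Finset.sum_congr rfl fun k hk => (hrα k (mem_nonzeroIntegers.1 hk).1).limUnder_eq
    · exact Finset.sum_congr rfl fun k hk => (hrβ k (mem_nonzeroIntegers.1 hk).1).limUnder_eq
  · intro w hw
    rcases Finset.mem_insert.1 hw with rfl | hw
    · simpa using hR0
    rcases Finset.mem_union.1 hw with hw | hw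
    · exact hball α hα (fun n => (hR n).1) w hw
    · exact hball β hβ (fun n => (hR n).2) w hw
  · intro z hz hzS
    simp only [hS, Finset.mem_insert, Finset.mem_union, not_or] at hzS
    exact differentiableAt_poleKernel hα.ne' hβ.ne' hzS.1
      (fun h => hzS.2.1 (hpole α hα z hz hzS.1 h)) fun h => hzS.2.2 (hpole β hβ z hz hzS.1 h)

theorem tendsto_sum_poleResidue {α β u δ : ℝ} (hα : 0 < α) (hβ : 0 < β)
    (hαβ : Irrational (β / α)) (hu : u ≠ 0) (hu' : 2 * |u| < α + β) (hδ : 0 < δ) :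
    Tendsto (fun R : ℝ => ∑ k ∈ Finset.Icc 1 ⌊R * α⌋₊, poleResidue α β u (k : ℕ) +
        ∑ k ∈ Finset.Icc 1 ⌊R * β⌋₊, poleResidue β α u (k : ℕ))
      (atTop ⊓ 𝓟 (realHeights α β δ))
      (𝓝 ((u ^ 2 - (α ^ 2 + β ^ 2) / 12) / (α * β))) := by
  have h := tendsto_circleIntegral_poleKernel hα hβ hδ hu'
  have hne : (2 * Real.pi * Complex.I : ℂ) ≠ 0 := Complex.two_pi_I_ne_zero
  have h2 := (Complex.continuous_re.tendsto _).comp (h.const_mul (2 * Real.pi * Complex.I : ℂ)⁻¹)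
  have h3 := ((h2.sub_const (((α ^ 2 + β ^ 2) / 6 - 2 * u ^ 2) / (α * β))).const_mul (1 / 2))
  have hval : 1 / 2 * (((2 * Real.pi * Complex.I : ℂ)⁻¹ * 0).re -
      ((α ^ 2 + β ^ 2) / 6 - 2 * u ^ 2) / (α * β)) =
      (u ^ 2 - (α ^ 2 + β ^ 2) / 12) / (α * β) := by
    rw [mul_zero, Complex.zero_re]
    ring
  rw [hval] at h3
  refine h3.congr' ?_
  filter_upwards [mem_inf_of_right (mem_principal_self _),
    (eventually_gt_atTop (0 : ℝ)).filter_mono inf_le_left] with R hR hR0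
  rw [Function.comp_apply, circleIntegral_poleKernel hα hβ hαβ hu hδ hR0 hR,
    inv_mul_cancel_left₀ hne, Complex.ofReal_re]
  ring

/-! ### Cotangent sums and their shifts. -/

/-- The partial sum of the cotangent series, in terms of `α = log a`, `β = log b`, `t = log x`. -/
noncomputable def cotSum (α β t : ℝ) (K : ℕ) : ℝ :=
  ∑ k ∈ Finset.Icc 1 K, Real.cos (Real.pi * k * β / α) * Real.cos (2 * Real.pi * k * (t / α)) /
    (k * Real.sin (Real.pi * k * β / α))

theorem sin_nat_ne_zero {α β : ℝ} (hαβ : Irrational (β / α)) {k K : ℕ}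
    (hk : k ∈ Finset.Icc 1 K) : Real.sin (Real.pi * k * β / α) ≠ 0 := by
  have hk0 : (k : ℤ) ≠ 0 := by
    have := (Finset.mem_Icc.1 hk).1
    omega
  simpa using sin_pi_mul_div_ne_zero hαβ hk0

theorem cast_ne_zero_of_mem_Icc {k K : ℕ} (hk : k ∈ Finset.Icc 1 K) : (k : ℝ) ≠ 0 := by
  have := (Finset.mem_Icc.1 hk).1
  exact_mod_cast (by omega : k ≠ 0)

/-- The shift of `u` by `(α + β) / 2` adds `π k β / α + π k` to the angle. The `π k` cancels against
`cos (π k)`, and the addition formula splits off the sine term. -/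
theorem cotSum_eq_poleResidue {α β : ℝ} (hα : 0 < α) (hαβ : Irrational (β / α)) (t : ℝ) (K : ℕ) :
    cotSum α β t K =
      Real.pi * ∑ k ∈ Finset.Icc 1 K, poleResidue α β (t + (α + β) / 2) (k : ℕ) +
        ∑ k ∈ Finset.Icc 1 K, Real.sin (2 * Real.pi * k * (t / α)) / k := by
  rw [cotSum, Finset.mul_sum, ← Finset.sum_add_distrib]
  refine Finset.sum_congr rfl fun k hk => ?_
  have hs := sin_nat_ne_zero hαβ hk
  have hk0 := cast_ne_zero_of_mem_Icc hk
  rw [poleResidue]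
  push_cast
  set s := Real.sin (Real.pi * k * β / α) with hsdef
  have hsk : Real.sin (Real.pi * k) = 0 := by rw [mul_comm, Real.sin_nat_mul_pi]
  have hck : Real.cos (Real.pi * k) ^ 2 = 1 := by
    have := Real.sin_sq_add_cos_sq (Real.pi * k)
    rw [hsk] at this
    linarith
  have harg : 2 * Real.pi * (t + (α + β) / 2) * (k / α) =
      2 * Real.pi * k * (t / α) + Real.pi * k * β / α + Real.pi * k := by
    field_simp
    ring
  have hnum : Real.cos (2 * Real.pi * (t + (α + β) / 2) * (k / α)) * Real.cos (Real.pi * k) =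
      Real.cos (2 * Real.pi * k * (t / α)) * Real.cos (Real.pi * k * β / α) -
        Real.sin (2 * Real.pi * k * (t / α)) * s := by
    rw [harg, Real.cos_add _ (Real.pi * k), hsk, mul_zero, sub_zero, mul_assoc, ← sq, hck, mul_one,
      Real.cos_add]
  rw [hnum]
  field_simp
  ring

theorem cotSum_sub_self {α β : ℝ} (hα : 0 < α) (t : ℝ) (K : ℕ) :
    cotSum α β t K = cotSum α β (t - α) K := by
  refine Finset.sum_congr rfl fun k _ => ?_
  rw [show 2 * Real.pi * k * ((t - α) / α) = 2 * Real.pi * k * (t / α) - k * (2 * Real.pi) by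
    field_simp, Real.cos_sub_nat_mul_two_pi]

/-- With `θ = π k β / α`, the identity is `cot θ (cos (φ + θ) - cos (φ - θ)) = -2 cos θ sin φ =
-(sin (φ + θ) + sin (φ - θ))`: the small denominators cancel in the difference. -/
theorem cotSum_sub_period {α β : ℝ} (hαβ : Irrational (β / α)) (t : ℝ) (K : ℕ) :
    cotSum α β t K = cotSum α β (t - β) K -
      (∑ k ∈ Finset.Icc 1 K, Real.sin (2 * Real.pi * k * (t / α)) / k +
        ∑ k ∈ Finset.Icc 1 K, Real.sin (2 * Real.pi * k * ((t - β) / α)) / k) := by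
  rw [cotSum, cotSum, ← Finset.sum_add_distrib, ← Finset.sum_sub_distrib]
  refine Finset.sum_congr rfl fun k hk => ?_
  have hs := sin_nat_ne_zero hαβ hk
  have hk0 := cast_ne_zero_of_mem_Icc hk
  set θ := Real.pi * k * β / α with hθ
  obtain ⟨φ, hφ⟩ : ∃ φ, φ = 2 * Real.pi * k * (t / α) - θ := ⟨_, rfl⟩
  rw [show 2 * Real.pi * k * (t / α) = φ + θ by rw [hφ]; ring,
    show 2 * Real.pi * k * ((t - β) / α) = φ - θ by rw [hφ, hθ]; ring,
    Real.cos_add, Real.cos_sub, Real.sin_add, Real.sin_sub]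
  field_simp
  ring

theorem tendsto_floor_mul {α : ℝ} (hα : 0 < α) (S : Set ℝ) :
    Tendsto (fun R : ℝ => ⌊R * α⌋₊) (atTop ⊓ 𝓟 S) atTop :=
  (tendsto_nat_floor_atTop.comp (tendsto_id.atTop_mul_const hα)).mono_left inf_le_left

/-! ### Weighted lattice point count. -/

open Classical in
/-- The number of `(p, q)` with `p * α + q * β ≤ t`, where points on the boundary line count
one half. -/
noncomputable def starCount (α β t : ℝ) : ℝ :=
  (Set.ncard {pq : ℕ × ℕ | (pq.1 : ℝ) * α + pq.2 * β ≤ t} : ℝ) -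
    if ∃ p q : ℕ, t = p * α + q * β then 1 / 2 else 0

theorem starCount_of_neg {α β t : ℝ} (hα : 0 < α) (hβ : 0 < β) (ht : t < 0) :
    starCount α β t = 0 := by
  have h1 : {pq : ℕ × ℕ | (pq.1 : ℝ) * α + pq.2 * β ≤ t} = ∅ := by
    ext ⟨p, q⟩
    have : (0 : ℝ) ≤ p * α + q * β := by positivity
    simp only [Set.mem_ofPred_eq, Set.mem_empty_iff_false, iff_false, not_le]
    linarith
  have h2 : ¬ ∃ p q : ℕ, t = p * α + q * β := by
    rintro ⟨p, q, h⟩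
    have : (0 : ℝ) ≤ p * α + q * β := by positivity
    linarith
  rw [starCount, h1, if_neg h2]
  simp

theorem finite_lattice {α β : ℝ} (hα : 0 < α) (hβ : 0 < β) (t : ℝ) :
    {pq : ℕ × ℕ | (pq.1 : ℝ) * α + pq.2 * β ≤ t}.Finite := by
  refine ((Set.finite_Iic ⌊t / α⌋₊).prod (Set.finite_Iic ⌊t / β⌋₊)).subset ?_
  rintro ⟨p, q⟩ h
  simp only [Set.mem_ofPred_eq] at h
  have h1 : (0 : ℝ) ≤ p * α := by positivity
  have h2 : (0 : ℝ) ≤ q * β := by positivity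
  refine ⟨Nat.le_floor ?_, Nat.le_floor ?_⟩
  · rw [le_div_iff₀ hα]; linarith
  · rw [le_div_iff₀ hβ]; linarith

/-- Points with `p ≥ 1` are translates of those for `t - α`; the column `p = 0` has `⌊t / β⌋₊ + 1`
points. -/
theorem ncard_lattice_step {α β t : ℝ} (hα : 0 < α) (hβ : 0 < β) (ht : 0 ≤ t) :
    Set.ncard {pq : ℕ × ℕ | (pq.1 : ℝ) * α + pq.2 * β ≤ t} =
      Set.ncard {pq : ℕ × ℕ | (pq.1 : ℝ) * α + pq.2 * β ≤ t - α} + (⌊t / β⌋₊ + 1) := by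
  have hU : {pq : ℕ × ℕ | (pq.1 : ℝ) * α + pq.2 * β ≤ t} =
      (fun pq : ℕ × ℕ => (pq.1 + 1, pq.2)) ''
          {pq : ℕ × ℕ | (pq.1 : ℝ) * α + pq.2 * β ≤ t - α} ∪
        (fun q : ℕ => (0, q)) '' Set.Iic ⌊t / β⌋₊ := by
    ext ⟨p, q⟩
    simp only [Set.mem_ofPred_eq, Set.mem_union, Set.mem_image, Prod.exists, Prod.mk.injEq,
      Set.mem_Iic]
    constructor
    · intro h
      rcases p with _ | p
      · right
        refine ⟨q, Nat.le_floor ?_, rfl, rfl⟩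
        rw [le_div_iff₀ hβ]
        simpa using h
      · left
        refine ⟨p, q, ?_, rfl, rfl⟩
        push_cast at h
        linarith
    · rintro (⟨p', q', h, rfl, rfl⟩ | ⟨q', h, rfl, rfl⟩)
      · push_cast
        linarith
      · have := (Nat.le_floor_iff (by positivity)).1 h
        rw [le_div_iff₀ hβ] at this
        simpa using this
  rw [hU, Set.ncard_union_eq _ ((finite_lattice hα hβ _).image _) ((Set.finite_Iic _).image _),
    Set.ncard_image_of_injective, Set.ncard_image_of_injective]
  · congr 1
    rw [← Finset.coe_Iic, Set.ncard_coe_finset, Nat.card_Iic]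
  · intro q q' h
    simpa using h
  · rintro ⟨p, q⟩ ⟨p', q'⟩ h
    simpa using h
  · rw [Set.disjoint_left]
    rintro _ ⟨⟨p, q⟩, -, rfl⟩ ⟨q', -, h⟩
    simp at h

theorem starCount_step {α β t : ℝ} (hα : 0 < α) (hβ : 0 < β) (hαβ : Irrational (α / β))
    (ht : 0 ≤ t) :
    starCount α β t = starCount α β (t - α) + (t / β + 1 / 2 - bernoulliStar (t / β)) := by
  have hy : 0 ≤ t / β := by positivity
  have hfl : ((⌊t / β⌋₊ : ℕ) : ℝ) = t / β - Int.fract (t / β) := by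
    rw [natCast_floor_eq_intCast_floor hy, Int.self_sub_fract]
  rw [starCount, starCount, ncard_lattice_step hα hβ ht]
  push_cast
  -- If `t = n β`, the point `(0, n)` lies on the boundary and irrationality excludes boundary
  -- points for `t - α`; the lost half matches the value `0` of `bernoulliStar`. Otherwise the
  -- boundary corrections at `t` and `t - α` coincide.
  by_cases hint : ∃ n : ℤ, t / β = n
  · obtain ⟨n, hn⟩ := hint
    have htn : t = n * β := by rw [← hn]; field_simp
    have hn0 : 0 ≤ n := by
      rw [hn] at hy
      exact_mod_cast hy
    lift n to ℕ using hn0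
    push_cast at htn hn
    have h1 : ∃ p q : ℕ, t = p * α + q * β := ⟨0, n, by simpa using htn⟩
    have h2 : ¬ ∃ p q : ℕ, t - α = p * α + q * β := by
      rintro ⟨p, q, h⟩
      have hp : ((p : ℤ) + 1) ≠ 0 := by omega
      refine (hαβ.intCast_mul hp).ne_int ((n : ℤ) - q) ?_
      push_cast
      field_simp
      linarith
    have hb : bernoulliStar (t / β) = 0 := by
      rw [hn]; exact_mod_cast bernoulliStar_intCast n
    rw [if_pos h1, if_neg h2, hb, hfl, hn, Int.fract_natCast]
    ring
  · push Not at hint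
    have hiff : (∃ p q : ℕ, t = p * α + q * β) ↔ ∃ p q : ℕ, t - α = p * α + q * β := by
      constructor
      · rintro ⟨p, q, h⟩
        rcases p with _ | p
        · exfalso
          refine hint q ?_
          rw [h]
          push_cast
          field_simp
          ring
        · exact ⟨p, q, by rw [h]; push_cast; ring⟩
      · rintro ⟨p, q, h⟩
        exact ⟨p + 1, q, by push_cast; linarith⟩
    rw [bernoulliStar_of_ne hint, hfl]
    by_cases h : ∃ p q : ℕ, t = p * α + q * β
    · rw [if_pos h, if_pos (hiff.1 h)]
      ring
    · rw [if_neg h, if_neg (fun h' => h (hiff.2 h'))]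
      ring

/-! ### The joint value of the series, by induction on `t`. -/

/-- The value of the joint series that the counting formula predicts. -/
noncomputable def seriesValue (α β t : ℝ) : ℝ :=
  2 * Real.pi * (t ^ 2 / (2 * α * β) + t / (2 * α) + t / (2 * β) + 1 / 4 + α / (12 * β) +
    β / (12 * α) - 1 / 2 * bernoulliStar (t / α) - 1 / 2 * bernoulliStar (t / β) -
    starCount α β t)

theorem tendsto_cotSum_of_neg {α β t δ : ℝ} (hα : 0 < α) (hαβ : α < β)
    (hirr : Irrational (β / α)) (hδ : 0 < δ) (ht : -α ≤ t) (ht0 : t < 0) :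
    Tendsto (fun R : ℝ => cotSum α β t ⌊R * α⌋₊ + cotSum β α t ⌊R * β⌋₊)
      (atTop ⊓ 𝓟 (realHeights α β δ)) (𝓝 (seriesValue α β t)) := by
  have hβ : 0 < β := hα.trans hαβ
  have hirr' : Irrational (α / β) := by rw [← inv_div]; exact hirr.inv
  have hu0 : 0 < t + (α + β) / 2 := by linarith
  -- `t < 0` gives `2 u < α + β`, while `t ≥ -α` and `α < β` give `u > 0`.
  have h1 := tendsto_sum_poleResidue hα hβ hirr hu0.ne' (by rw [abs_of_pos hu0]; linarith) hδ
  have h2 := (tendsto_sum_sin_div (t / α)).comp (tendsto_floor_mul hα (realHeights α β δ))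
  have h3 := (tendsto_sum_sin_div (t / β)).comp (tendsto_floor_mul hβ (realHeights α β δ))
  have h4 := ((h1.const_mul Real.pi).add h2).add h3
  have hval : Real.pi * (((t + (α + β) / 2) ^ 2 - (α ^ 2 + β ^ 2) / 12) / (α * β)) +
      -Real.pi * bernoulliStar (t / α) + -Real.pi * bernoulliStar (t / β) =
      seriesValue α β t := by
    rw [seriesValue, starCount_of_neg hα hβ ht0]
    field_simp
    ring
  rw [hval] at h4
  refine h4.congr fun R => ?_
  rw [cotSum_eq_poleResidue hα hirr, cotSum_eq_poleResidue hβ hirr', add_comm β α]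
  simp only [Function.comp_apply]
  ring

/-- The first series has period `α` in `t`; the second changes by sawtooth sums converging to the
values that `starCount_step` requires. -/
theorem tendsto_cotSum_step {α β t δ : ℝ} (hα : 0 < α) (hβ : 0 < β)
    (hirr : Irrational (α / β)) (ht : 0 ≤ t)
    (h : Tendsto (fun R : ℝ => cotSum α β (t - α) ⌊R * α⌋₊ + cotSum β α (t - α) ⌊R * β⌋₊)
      (atTop ⊓ 𝓟 (realHeights α β δ)) (𝓝 (seriesValue α β (t - α)))) :
    Tendsto (fun R : ℝ => cotSum α β t ⌊R * α⌋₊ + cotSum β α t ⌊R * β⌋₊)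
      (atTop ⊓ 𝓟 (realHeights α β δ)) (𝓝 (seriesValue α β t)) := by
  have h2 := (tendsto_sum_sin_div (t / β)).comp (tendsto_floor_mul hβ (realHeights α β δ))
  have h3 := (tendsto_sum_sin_div ((t - α) / β)).comp (tendsto_floor_mul hβ (realHeights α β δ))
  have h4 := h.sub (h2.add h3)
  have hval : seriesValue α β (t - α) - (-Real.pi * bernoulliStar (t / β) +
      -Real.pi * bernoulliStar ((t - α) / β)) = seriesValue α β t := by
    have hb : bernoulliStar ((t - α) / α) = bernoulliStar (t / α) := by
      rw [sub_div, div_self hα.ne', bernoulliStar_sub_one]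
    rw [seriesValue, seriesValue, starCount_step hα hβ hirr ht, hb]
    field_simp
    ring
  rw [hval] at h4
  refine h4.congr fun R => ?_
  rw [cotSum_sub_self hα t, cotSum_sub_period hirr t]
  simp only [Function.comp_apply]
  ring

theorem tendsto_cotSum {α β δ : ℝ} (hα : 0 < α) (hαβ : α < β) (hirr : Irrational (β / α))
    (hδ : 0 < δ) {t : ℝ} (ht : -α ≤ t) :
    Tendsto (fun R : ℝ => cotSum α β t ⌊R * α⌋₊ + cotSum β α t ⌊R * β⌋₊)
      (atTop ⊓ 𝓟 (realHeights α β δ)) (𝓝 (seriesValue α β t)) := by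
  have hβ : 0 < β := hα.trans hαβ
  have hirr' : Irrational (α / β) := by rw [← inv_div]; exact hirr.inv
  -- Induction on the number of steps of length `α` needed to bring `t` into `[-α, 0)`.
  have key : ∀ n : ℕ, ∀ t : ℝ, -α ≤ t → t < n * α →
      Tendsto (fun R : ℝ => cotSum α β t ⌊R * α⌋₊ + cotSum β α t ⌊R * β⌋₊)
        (atTop ⊓ 𝓟 (realHeights α β δ)) (𝓝 (seriesValue α β t)) := by
    intro n
    induction n with
    | zero =>
      intro t h1 h2
      exact tendsto_cotSum_of_neg hα hαβ hirr hδ h1 (by simpa using h2)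
    | succ n ih =>
      intro t h1 h2
      rcases lt_or_ge t 0 with h0 | h0
      · exact tendsto_cotSum_of_neg hα hαβ hirr hδ h1 h0
      · refine tendsto_cotSum_step hα hβ hirr' h0 (ih _ (by linarith) ?_)
        push_cast at h2
        linarith
  obtain ⟨n, hn⟩ := exists_nat_gt (t / α)
  exact key n t ht ((div_lt_iff₀ hα).1 hn)

/-! ### Return to integers and logarithms. -/

/-- A rational ratio would give `a ^ m = b ^ n` with `n ≥ 1`; coprime equal numbers are `1`, but `b
^ n > 1`. -/
theorem irrational_log_div_log {a b : ℕ} (ha : 1 < a) (hb : 1 < b) (hab : Nat.Coprime a b) :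
    Irrational (Real.log b / Real.log a) := by
  have hla : 0 < Real.log a := Real.log_pos (by exact_mod_cast ha)
  have hlb : 0 < Real.log b := Real.log_pos (by exact_mod_cast hb)
  rintro ⟨q, hq⟩
  have hq0 : 0 < q := by
    have : (0 : ℝ) < q := by rw [hq]; positivity
    exact_mod_cast this
  have hnum : (0 : ℤ) < q.num := Rat.num_pos.2 hq0
  have h1 : (q : ℝ) = (q.num.toNat : ℝ) / q.den := by
    have h2 : ((q.num.toNat : ℕ) : ℝ) = ((q.num : ℤ) : ℝ) := by
      exact_mod_cast Int.toNat_of_nonneg hnum.le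
    rw [h2]
    exact_mod_cast (Rat.num_div_den q).symm
  have hden : (q.den : ℝ) ≠ 0 := by exact_mod_cast q.den_nz
  rw [h1, div_eq_div_iff hden hla.ne', mul_comm (Real.log b), ← Real.log_pow, ← Real.log_pow] at hq
  have h3 := Real.log_injOn_pos (Set.mem_Ioi.2 (by positivity)) (Set.mem_Ioi.2 (by positivity)) hq
  have h4 : a ^ q.num.toNat = b ^ q.den := by exact_mod_cast h3
  have h5 : Nat.Coprime (a ^ q.num.toNat) (b ^ q.den) := hab.pow _ _
  rw [h4, Nat.coprime_self] at h5
  have := Nat.one_lt_pow q.den_nz hb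
  omega

theorem log_pow_mul_pow {a b : ℕ} (ha : 1 < a) (hb : 1 < b) (p q : ℕ) :
    Real.log ((a : ℝ) ^ p * (b : ℝ) ^ q) = p * Real.log a + q * Real.log b := by
  have ha' : (a : ℝ) ≠ 0 := by positivity
  have hb' : (b : ℝ) ≠ 0 := by positivity
  rw [Real.log_mul (pow_ne_zero _ ha') (pow_ne_zero _ hb'), Real.log_pow, Real.log_pow]

theorem starCount_log {a b : ℕ} (ha : 1 < a) (hb : 1 < b) {x : ℝ} (hx : 0 < x) :
    starCount (Real.log a) (Real.log b) (Real.log x) = countN a b x - 1 / 2 * chiS a b x := by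
  have hpos : ∀ p q : ℕ, 0 < (a : ℝ) ^ p * (b : ℝ) ^ q := fun p q => by positivity
  have h1 : {pq : ℕ × ℕ | (pq.1 : ℝ) * Real.log a + pq.2 * Real.log b ≤ Real.log x} =
      {pq : ℕ × ℕ | (a : ℝ) ^ pq.1 * (b : ℝ) ^ pq.2 ≤ x} := by
    ext ⟨p, q⟩
    simp only [Set.mem_ofPred_eq]
    rw [← log_pow_mul_pow ha hb, Real.log_le_log_iff (hpos p q) hx]
  have h2 : (∃ p q : ℕ, Real.log x = p * Real.log a + q * Real.log b) ↔ x ∈ smoothSet a b := by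
    refine exists_congr fun p => exists_congr fun q => ?_
    rw [← log_pow_mul_pow ha hb]
    exact Real.log_injOn_pos.eq_iff (Set.mem_Ioi.2 hx) (Set.mem_Ioi.2 (hpos p q))
  rw [starCount, h1, countN, chiS]
  by_cases h : x ∈ smoothSet a b
  · rw [if_pos (h2.2 h), Set.indicator_of_mem h, mul_one]
  · rw [if_neg (fun h' => h (h2.1 h')), Set.indicator_of_notMem h, mul_zero]

theorem exists_seriesValue {a b : ℕ} (ha : 1 < a) (hab : a < b) (hcop : Nat.Coprime a b)
    {x : ℝ} (hx : 1 ≤ x) :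
    ∃ L : ℝ, IsSeriesValue a b x L ∧
      (countN a b x : ℝ) =
        Real.log x ^ 2 / (2 * Real.log a * Real.log b)
          + Real.log x / (2 * Real.log a) + Real.log x / (2 * Real.log b)
          + 1 / 4 + Real.log a / (12 * Real.log b) + Real.log b / (12 * Real.log a)
          - 1 / 2 * bernoulliStar (Real.log x / Real.log a)
          - 1 / 2 * bernoulliStar (Real.log x / Real.log b)
          - 1 / (2 * Real.pi) * L
          + 1 / 2 * chiS a b x := by
  have hα : 0 < Real.log a := Real.log_pos (by exact_mod_cast ha)
  have hαβ : Real.log a < Real.log b :=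
    Real.log_lt_log (by positivity) (by exact_mod_cast hab)
  have hirr := irrational_log_div_log ha (ha.trans hab) hcop
  have ht : -Real.log a ≤ Real.log x := by linarith [Real.log_nonneg hx]
  refine ⟨seriesValue (Real.log a) (Real.log b) (Real.log x), ⟨⟨1 / 8, by norm_num, ?_⟩, ?_⟩, ?_⟩
  · exact exists_mem_realHeights hα hαβ.le
  · exact fun δ hδ => tendsto_cotSum hα hαβ hirr hδ ht
  · rw [seriesValue, starCount_log ha (ha.trans hab) (by linarith), ← mul_assoc,
      one_div_mul_cancel Real.two_pi_pos.ne']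
    ring

theorem corollary14 :
    (∀ a b : ℕ, 1 < a → a < b → Nat.Coprime a b → ∀ x : ℝ, 1 ≤ x →
      ∃ L : ℝ, IsSeriesValue a b x L ∧
        (countN a b x : ℝ) =
          Real.log x ^ 2 / (2 * Real.log a * Real.log b)
            + Real.log x / (2 * Real.log a) + Real.log x / (2 * Real.log b)
            + 1 / 4 + Real.log a / (12 * Real.log b) + Real.log b / (12 * Real.log a)
            - 1 / 2 * bernoulliStar (Real.log x / Real.log a)
            - 1 / 2 * bernoulliStar (Real.log x / Real.log b)
            - 1 / (2 * Real.pi) * L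
            + 1 / 2 * chiS a b x) ∧
    (∀ x : ℝ, 1 ≤ x →
      ∃ L : ℝ, IsSeriesValue 2 3 x L ∧
        (countN 2 3 x : ℝ) =
          Real.log x ^ 2 / (2 * Real.log 2 * Real.log 3)
            + Real.log x / (2 * Real.log 2) + Real.log x / (2 * Real.log 3)
            + 1 / 4 + Real.log 2 / (12 * Real.log 3) + Real.log 3 / (12 * Real.log 2)
            - 1 / 2 * bernoulliStar (Real.log x / Real.log 2)
            - 1 / 2 * bernoulliStar (Real.log x / Real.log 3)
            - 1 / (2 * Real.pi) * L
            + 1 / 2 * chiS 2 3 x) := by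
  refine ⟨fun a b ha hab hcop x hx => exists_seriesValue ha hab hcop hx, fun x hx => ?_⟩
  have h := exists_seriesValue (a := 2) (b := 3) (by norm_num) (by norm_num) (by norm_num) hx
  simpa only [Nat.cast_ofNat] using h
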